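/- **Setting.** Let $d\ge 2$, $n\ge 1$, $r\ge 0$ be integers and let $\triangle$ be a finite face-to-face simplicial partition, into $d$-simplices, of a closed polyhedral set $\Omega\subset\mathbb{R}^d$. Let $|\triangle|$ be the largest diameter of its simplices and $\rho_T$ the inradius of a simplex $T$; $\triangle$ is $\beta$-quasi-uniform if $|\triangle|/\rho_T\le\beta$ for all $T\in\triangle$. Let $S^r_n(\triangle)$ be the space of functions that are continuous on $\Omega$, $C^r$ in its interior, and polynomial of degree at most $n$ on each simplex, and let $\mathcal W=S^r_n(\triangle)\cap H^1_0(\Omega)$. For a vertex or simplex $s$, $\mathrm{star}^1(s)$ is the collection (or union) of the simplices sharing a vertex with $s$, and $\mathrm{star}^{k+1}(s)$ that of the simplices sharing a vertex with a simplex of $\mathrm{star}^{k}(s)$. For a boundary vertex $v_i$ let $\ell_i:\partial\Omega\to\mathbb{R}$ be $1$ at $v_i$, $0$ at the other boundary vertices, and linear on each boundary simplex. Let $S_i$ be a minimizer of $\int_\Omega|\nabla u|^2$ over all $u\in S^r_n(\triangle)$ with $u=\ell_i$ on $\partial\Omega$. Put $\Omega_i=\mathrm{star}^1(v_i)$. For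 $T\in\triangle$ with $\mathrm{star}^k(T)\cap\Omega_i=\emptyset$, say that $T$ is *$L$ simplices away from $\partial\Omega\setminus\Omega_i$ in the direction opposite to $v_i$* if $L$ is the smallest integer for which there are simplices $T=T_1,\dots,T_{L+1}$ of $\triangle$ and integers $0\le e_1\le\dots\le e_{L+1}$ such that consecutive simplices intersect, $T_{L+1}$ meets $\partial\Omega\setminus\Omega_i$, and, for every $j$, $T_j\in\mathrm{star}^{k+e_j}(T)$ and $\mathrm{star}^{k+e_j}(T)\cap\Omega_i=\emptyset$. For $\ell\ge 1$ and $\kappa\in\mathbb{R}$, say that $\mathcal W$ has an *$\ell$-local Riesz basis of ratio at most $\kappa$* if it has a basis $\{B_\xi\}$, each $B_\xi$ supported in $\mathrm{star}^\ell(T_\xi)$ for some $T_\xi\in\triangle$, and constants $C_1>0$, $C_2\le\kappa C_1$, with $$C_1\sum_\xi|c_\xi|^2\le\Big\|\nabla\sum_\xi c_\xi B_\xi\Big\|_{L^2(\Omega)}^2\le C_2\sum_\xi|c_\xi|^2\qquad\text{for all coefficients }(c_\xi).$$ **Theorem.** (1) For every $\kappa$ and $\ell\ge1$ there is $\sigma\in(0,1)$,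 and for all $d\ge 2$, $n\ge1$, $\beta$, $A$ there is then a constant $K>0$ (depending only on $\kappa,\ell,d,n,\beta,A$), such that the following holds. Let $\triangle$ be a $\beta$-quasi-uniform partition as above for which $\mathcal W=S^r_n(\triangle)\cap H_0^1(\Omega)$ has an $\ell$-local Riesz basis of ratio at most $\kappa$, and let $v_i$ be a boundary vertex. If $r\ge 1$, assume also that there is $G_i\in S^r_n(\triangle)$ with $G_i=\ell_i$ on $\partial\Omega$, supported in $\mathrm{star}^\ell(v_i)$, with $\|\nabla G_i\|_{L^2(\Omega)}^2\le A|\triangle|^{d-2}$. Let $v\in\Omega\setminus\Omega_i$, let $T\in\triangle$ contain $v$, let $k\ge1$ satisfy $\mathrm{star}^k(T)\cap\Omega_i=\emptyset$, and let $L\ge1$ be such that $T$ is $L$ simplices away from $\partial\Omega\setminus\Omega_i$ in the direction opposite to $v_i$. Then $$|S_i(v)|\le K\,(L+1)\,\sigma^k .$$ In particular $K$ and $\sigma$ do not depend on $L,k,v,T,v_i$, and depend on $\triangle$ and $\Omega$ only through the stated parameters. (2) For continuous splines ($r=0$) the basis in (1) always exists: for all $d\ge2$, $n\ge1$ and every partition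 $\triangle$ there is a $\kappa$ such that $S^0_n(\triangle)\cap H^1_0(\Omega)$ has a $1$-local Riesz basis of ratio at most $\kappa$. -/

import Mathlib

open Set MeasureTheory

noncomputable section

namespace GBC

/-- A simplicial partition of a polyhedral set in `ℝ^d`: a finite (face-to-face) geometric
simplicial complex in which every face is a face of a `d`-dimensional simplex. A simplex is
recorded by the finite set of its vertices. -/
structure SimplicialPartition (d : ℕ) where
  complex : Geometry.SimplicialComplex ℝ (EuclideanSpace ℝ (Fin d))
  finite : complex.faces.Finite
  pure : ∀ s ∈ complex.faces, ∃ T ∈ complex.faces, s ⊆ T ∧ T.card = d + 1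

namespace SimplicialPartition

variable {d : ℕ} (P : SimplicialPartition d)

/-- The `d`-dimensional simplices of the partition (given by their `d + 1` vertices). -/
def simplices : Set (Finset (EuclideanSpace ℝ (Fin d))) :=
  {T | T ∈ P.complex.faces ∧ T.card = d + 1}

/-- The closed polyhedral set `Ω` that is partitioned. -/
def domain : Set (EuclideanSpace ℝ (Fin d)) := P.complex.space

/-- The size `|△|`: the largest diameter of the simplices. -/
def meshSize : ℝ :=
  sSup ((fun T : Finset (EuclideanSpace ℝ (Fin d)) =>
    Metric.diam (convexHull ℝ (T : Set (EuclideanSpace ℝ (Fin d))))) '' P.simplices)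

/-- The radius `ρ_T` of the inscribed ball of the simplex with vertex set `T`. -/
def inradius (T : Finset (EuclideanSpace ℝ (Fin d))) : ℝ :=
  sSup {ρ : ℝ | ∃ x, Metric.closedBall x ρ ⊆ convexHull ℝ (T : Set (EuclideanSpace ℝ (Fin d)))}

/-- `β`-quasi-uniformity: `|△| / ρ_T ≤ β` for every simplex `T`. -/
def QuasiUniform (β : ℝ) : Prop :=
  ∀ T ∈ P.simplices, P.meshSize ≤ β * inradius T

/-- `star^k(s)` as a collection of simplices, for a finite set `s` of vertices: `star^1(s)` consists
of the simplices with a vertex in `s`, and `star^{k+1}(s)` of the simplices that share a vertex with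
a simplex of `star^k(s)`. For a vertex `p` it is used with `s = {p}`, for a simplex `T` with the
vertex set of `T`. The value at `k = 0` is never used. -/
def star (s : Finset (EuclideanSpace ℝ (Fin d))) : ℕ → Set (Finset (EuclideanSpace ℝ (Fin d)))
  | 0 => ∅
  | 1 => {T | T ∈ P.simplices ∧ ∃ q ∈ T, q ∈ s}
  | k + 2 => {T | T ∈ P.simplices ∧ ∃ T' ∈ star s (k + 1), ∃ q ∈ T, q ∈ T'}

/-- `star^k(s)` as a point set: the union of its (closed) simplices. -/
def starSet (s : Finset (EuclideanSpace ℝ (Fin d))) (k : ℕ) : Set (EuclideanSpace ℝ (Fin d)) :=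
  ⋃ T ∈ P.star s k, convexHull ℝ (T : Set (EuclideanSpace ℝ (Fin d)))

/-- The spline space `S^r_n(△)`: functions that are continuous on `Ω`, of class `C^r` in its
interior, and on each simplex equal to a polynomial of degree at most `n`. -/
def IsSpline (r n : ℕ) (u : EuclideanSpace ℝ (Fin d) → ℝ) : Prop :=
  ContinuousOn u P.domain ∧ ContDiffOn ℝ r u (interior P.domain) ∧
    ∀ T ∈ P.simplices, ∃ p : MvPolynomial (Fin d) ℝ, p.totalDegree ≤ n ∧
      ∀ x ∈ convexHull ℝ (T : Set (EuclideanSpace ℝ (Fin d))),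
        u x = MvPolynomial.eval (fun j => x j) p

/-- The space `W = S^r_n(△) ∩ H^1_0(Ω)`. A spline is continuous on `Ω` and piecewise polynomial, so
it lies in `H^1_0(Ω)` exactly if it vanishes on `∂Ω`. -/
def IsSplineZero (r n : ℕ) (u : EuclideanSpace ℝ (Fin d) → ℝ) : Prop :=
  P.IsSpline r n u ∧ ∀ x ∈ frontier P.domain, u x = 0

/-- The Dirichlet energy `‖∇u‖² = ∫_Ω |∇u|²`. For a spline `u` the classical gradient exists
off the null set of the faces of dimension less than `d`. -/
def energy (u : EuclideanSpace ℝ (Fin d) → ℝ) : ℝ :=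
  ∫ x in P.domain, ‖gradient u x‖ ^ 2

/-- `u = ℓ_p` on `∂Ω`, where `ℓ_p` is `1` at the vertex `p`, `0` at all other boundary vertices, and
linear on each boundary simplex: the value of `ℓ_p` at a boundary point which is a
convex combination of the vertices of a face is the coefficient of `p`. -/
def HasHatBoundaryValues (p : EuclideanSpace ℝ (Fin d)) (u : EuclideanSpace ℝ (Fin d) → ℝ) : Prop :=
  ∀ s ∈ P.complex.faces, ∀ w : EuclideanSpace ℝ (Fin d) → ℝ,
    (∀ q ∈ s, 0 ≤ w q) → ∑ q ∈ s, w q = 1 → ∑ q ∈ s, w q • q ∈ frontier P.domain →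
      (p ∈ s → u (∑ q ∈ s, w q • q) = w p) ∧ (p ∉ s → u (∑ q ∈ s, w q • q) = 0)

/-- `S` is a boundary GBC spline for the vertex `p`: it minimizes `∫_Ω |∇u|²` among all
`u ∈ S^r_n(△)` with `u = ℓ_p` on `∂Ω`. -/
def IsBoundaryGBCSpline (r n : ℕ) (p : EuclideanSpace ℝ (Fin d))
    (S : EuclideanSpace ℝ (Fin d) → ℝ) : Prop :=
  P.IsSpline r n S ∧ P.HasHatBoundaryValues p S ∧
    ∀ u, P.IsSpline r n u → P.HasHatBoundaryValues p u → P.energy S ≤ P.energy u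

/-- `W = S^r_n(△) ∩ H^1_0(Ω)` has an `ℓ`-local basis `B_ξ` (each `B_ξ` is supported in
`star^ℓ(T_ξ)` for some simplex `T_ξ`) that satisfies the Riesz inequalities
`C₁ ∑ |c_ξ|² ≤ ‖∇ ∑ c_ξ B_ξ‖² ≤ C₂ ∑ |c_ξ|²` with constants of ratio `C₂ / C₁ ≤ κ`.
(The lower inequality contains linear independence.) -/
def HasLocalRieszBasis (r n l : ℕ) (κ : ℝ) : Prop :=
  ∃ (m : ℕ) (B : Fin m → EuclideanSpace ℝ (Fin d) → ℝ)
    (τ : Fin m → Finset (EuclideanSpace ℝ (Fin d))) (C₁ C₂ : ℝ),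
    0 < C₁ ∧ C₂ ≤ κ * C₁ ∧
    (∀ ξ, P.IsSplineZero r n (B ξ)) ∧
    (∀ ξ, τ ξ ∈ P.simplices ∧ ∀ x ∈ P.domain, x ∉ P.starSet (τ ξ) l → B ξ x = 0) ∧
    (∀ u, P.IsSplineZero r n u → ∃ c : Fin m → ℝ, ∀ x ∈ P.domain, u x = ∑ ξ, c ξ * B ξ x) ∧
    ∀ c : Fin m → ℝ,
      C₁ * ∑ ξ, c ξ ^ 2 ≤ P.energy (fun x => ∑ ξ, c ξ * B ξ x) ∧
      P.energy (fun x => ∑ ξ, c ξ * B ξ x) ≤ C₂ * ∑ ξ, c ξ ^ 2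

/-- There is a spline `G ∈ S^r_n(△)` with `G = ℓ_p` on `∂Ω` that is supported in `star^ℓ(p)` and has
energy `‖∇G‖² ≤ A |△|^{d-2}` (the power of `|△|` makes the bound invariant under scaling). -/
def HasLocalLift (r n l : ℕ) (A : ℝ) (p : EuclideanSpace ℝ (Fin d)) : Prop :=
  ∃ G, P.IsSpline r n G ∧ P.HasHatBoundaryValues p G ∧
    (∀ x ∈ P.domain, x ∉ P.starSet {p} l → G x = 0) ∧
    P.energy G ≤ A * P.meshSize ^ (d - 2)

/-- There are simplices `T = T_1, …, T_{L+1}` (here `T_{j+1} = C j`), consecutive ones meeting, the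
last one meeting `∂Ω \ Ω_p` with `Ω_p = star(p)`, and numbers `0 ≤ e_1 ≤ … ≤ e_{L+1}` such that
`T_j ∈ star^{k + e_j}(T) ⊆ Ω_p^c` for all `j`. -/
def HasOppositeChain (p : EuclideanSpace ℝ (Fin d)) (k : ℕ)
    (T : Finset (EuclideanSpace ℝ (Fin d))) (L : ℕ) : Prop :=
  ∃ (C : ℕ → Finset (EuclideanSpace ℝ (Fin d))) (e : ℕ → ℕ),
    C 0 = T ∧ (∀ j ≤ L, C j ∈ P.simplices) ∧
    (∀ j < L, (convexHull ℝ (C j : Set (EuclideanSpace ℝ (Fin d))) ∩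
      convexHull ℝ (C (j + 1) : Set (EuclideanSpace ℝ (Fin d)))).Nonempty) ∧
    (convexHull ℝ (C L : Set (EuclideanSpace ℝ (Fin d))) ∩
      (frontier P.domain \ P.starSet {p} 1)).Nonempty ∧
    (∀ j < L, e j ≤ e (j + 1)) ∧
    ∀ j ≤ L, C j ∈ P.star T (k + e j) ∧ Disjoint (P.starSet T (k + e j)) (P.starSet {p} 1)

/-- `T` is `L` simplices away from `∂Ω \ Ω_p` in the direction opposite to `p`: `L` is the
smallest integer for which there is such a chain. -/
def IsSimplicesAwayOpposite (p : EuclideanSpace ℝ (Fin d)) (k : ℕ)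
    (T : Finset (EuclideanSpace ℝ (Fin d))) (L : ℕ) : Prop :=
  IsLeast {L' | P.HasOppositeChain p k T L'} L

end SimplicialPartition

end GBC

end

/-!
A boundary GBC spline `S` minimizes the Dirichlet energy, so its gradient is orthogonal in `L²(Ω)`
to the gradients of all splines in `W = S^r_n(△) ∩ H^1_0(Ω)`. Let `G` be a lift of `ℓ_p` that is
supported near `p` and expand `S - G ∈ W` in the local Riesz basis. Away from the support of `G` the
gradient of `S - G` is still orthogonal to the local basis functions, so the part of the expansion
far from `p` is controlled by the coefficients in a ring of `2l + 1` layers around it, and the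
coefficients decay by the factor `κ / (1 + κ)` per ring.

Near a given simplex `T` only the basis functions around `T` matter; their sum is a spline in `W` of
exponentially small energy whose support meets boundedly many layers around `T`. On a quasi-uniform
partition a spline of energy `a |△|^{d-2}` oscillates by at most a multiple of `√a` on each simplex,
and walking from `T` through these layers to a zero of the spline turns the energy estimate into a
pointwise one.

For `r = 0` the lift is the hat function of `p`. Continuous splines that vanish on `∂Ω` are spanned
by local ones: in the Bernstein form of `u`, keep only the Bernstein polynomials in the barycentric
coordinates of a set `A` of vertices. This operation preserves `W` because `∂Ω` is a union of faces,
and enlarging `A` by a vertex changes the result only in the star of that vertex. Finite dimension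
and definiteness of the energy make every basis a Riesz basis.
-/

noncomputable section

namespace GBC

local notation "hull" T:max => convexHull ℝ (SetLike.coe T)

namespace SimplicialPartition

variable {d : ℕ} {P : SimplicialPartition d} {s T T' : Finset (EuclideanSpace ℝ (Fin d))}
  {p q x y : EuclideanSpace ℝ (Fin d)} {j k : ℕ}

/-! ### Stars -/

lemma simplices_finite : P.simplices.Finite := P.finite.subset fun _ hT => hT.1

lemma nonempty_of_mem_simplices (hT : T ∈ P.simplices) : T.Nonempty :=
  P.complex.nonempty_of_mem_faces hT.1

lemma exists_common_vertex (hT : T ∈ P.simplices) (hT' : T' ∈ P.simplices)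
    (hx : x ∈ hull T) (hx' : x ∈ hull T') : ∃ q ∈ T, q ∈ T' := by
  obtain ⟨q, hq, hq'⟩ := convexHull_nonempty_iff.1
    ⟨x, P.complex.inter_subset_convexHull hT.1 hT'.1 ⟨hx, hx'⟩⟩
  exact ⟨q, hq, hq'⟩

lemma star_subset_simplices : P.star s k ⊆ P.simplices := by
  intro T hT
  match k with
  | 0 => exact hT.elim
  | 1 => exact hT.1
  | _ + 2 => exact hT.1

lemma mem_star_succ (hT : T ∈ P.simplices) (hT' : T' ∈ P.star s k) (hq : q ∈ T) (hq' : q ∈ T') :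
    T ∈ P.star s (k + 1) := by
  match k with
  | 0 => exact hT'.elim
  | _ + 1 => exact ⟨hT, T', hT', q, hq, hq'⟩

lemma star_mono (h : j ≤ k) : P.star s j ⊆ P.star s k := by
  induction h with
  | refl => exact subset_rfl
  | step _ ih =>
    intro T hT
    have hT_simplex := star_subset_simplices hT
    obtain ⟨q, hq⟩ := nonempty_of_mem_simplices hT_simplex
    exact mem_star_succ hT_simplex (ih hT) hq hq

lemma mem_star_self (hT : T ∈ P.simplices) (hk : 1 ≤ k) : T ∈ P.star T k := by
  obtain ⟨q, hq⟩ := nonempty_of_mem_simplices hT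
  exact star_mono hk ⟨hT, q, hq, hq⟩

lemma star_trans (hT : T ∈ P.star s j) (hT' : T' ∈ P.star T k) : T' ∈ P.star s (j + k) := by
  induction k generalizing T' with
  | zero => exact hT'.elim
  | succ k ih =>
    rcases k with _ | k
    · obtain ⟨hT'_simplex, q, hq, hqT⟩ := hT'
      exact mem_star_succ hT'_simplex hT hq hqT
    · obtain ⟨hT'_simplex, T₀, hT₀, q, hq, hqT₀⟩ := hT'
      exact mem_star_succ hT'_simplex (ih hT₀) hq hqT₀

lemma star_symm (hT : T ∈ P.simplices) (hT' : T' ∈ P.star T k) : T ∈ P.star T' k := by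
  induction k generalizing T' with
  | zero => exact hT'.elim
  | succ k ih =>
    rcases k with _ | k
    · obtain ⟨-, q, hq, hqT⟩ := hT'
      exact ⟨hT, q, hqT, hq⟩
    · obtain ⟨-, T₀, hT₀, q, hq, hqT₀⟩ := hT'
      have hT₀T' : T₀ ∈ P.star T' 1 := ⟨star_subset_simplices hT₀, q, hqT₀, hq⟩
      simpa only [add_comm] using star_trans hT₀T' (ih hT₀)

lemma exists_mem_star_one (hT : T ∈ P.star s (k + 2)) :
    ∃ T₁ ∈ P.star s 1, T ∈ P.star T₁ (k + 1) := by
  obtain ⟨hT_simplex, T', hT', q, hq, hq'⟩ := hT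
  induction k generalizing T T' q with
  | zero => exact ⟨T', hT', hT_simplex, q, hq, hq'⟩
  | succ k ih =>
    obtain ⟨hT'_simplex, T₀, hT₀, q₀, hq₀, hq₀'⟩ := hT'
    obtain ⟨T₁, hT₁, hT'T₁⟩ := ih hT'_simplex T₀ hT₀ q₀ hq₀ hq₀'
    exact ⟨T₁, hT₁, mem_star_succ hT_simplex hT'T₁ hq hq'⟩

lemma notMem_star_of_disjoint (hk : 1 ≤ k) (h : Disjoint (P.starSet T k) (P.starSet s 1)) :
    T ∉ P.star s (k + 1) := by
  intro hT
  obtain ⟨k, rfl⟩ := Nat.exists_eq_add_of_le' hk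
  obtain ⟨T₁, hT₁, hTT₁⟩ := exists_mem_star_one hT
  have hT₁_simplex := star_subset_simplices hT₁
  obtain ⟨q, hq⟩ := nonempty_of_mem_simplices hT₁_simplex
  have hq_hull : q ∈ hull T₁ := subset_convexHull ℝ _ hq
  exact h.le_bot
    ⟨mem_biUnion (star_symm hT₁_simplex hTT₁) hq_hull, mem_biUnion hT₁ hq_hull⟩

lemma mem_star_of_mem_starSet (hT : T ∈ P.simplices) (hxT : x ∈ hull T)
    (hx : x ∈ P.starSet s k) : T ∈ P.star s (k + 1) := by
  obtain ⟨T', hT', hxT'⟩ := mem_iUnion₂.1 hx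
  obtain ⟨q, hq, hq'⟩ := exists_common_vertex hT (star_subset_simplices hT') hxT hxT'
  exact mem_star_succ hT hT' hq hq'

lemma mem_star_of_mem_starSet_of_mem_starSet {t : Finset (EuclideanSpace ℝ (Fin d))}
    (ht : t ∈ P.simplices) (hs : x ∈ P.starSet s j) (hx : x ∈ P.starSet t k) :
    t ∈ P.star s (j + k + 1) := by
  obtain ⟨T, hT, hxT⟩ := mem_iUnion₂.1 hx
  have hTs := mem_star_of_mem_starSet (star_subset_simplices hT) hxT hs
  simpa only [add_right_comm] using star_trans hTs (star_symm ht hT)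

/-! ### The domain -/

lemma mem_domain_iff : x ∈ P.domain ↔ ∃ T ∈ P.simplices, x ∈ hull T := by
  refine ⟨fun hx => ?_, fun ⟨T, hT, hx⟩ => P.complex.mem_space_iff.2 ⟨T, hT.1, hx⟩⟩
  obtain ⟨s, hs, hxs⟩ := P.complex.mem_space_iff.1 hx
  obtain ⟨T, hT, hsT, hcard⟩ := P.pure s hs
  exact ⟨T, ⟨hT, hcard⟩, convexHull_mono (Finset.coe_subset.2 hsT) hxs⟩

lemma domain_eq_biUnion : P.domain = ⋃ T ∈ P.simplices, hull T := by
  ext x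
  simp only [mem_domain_iff, mem_iUnion, exists_prop]

lemma hull_subset_domain (hT : T ∈ P.simplices) : hull T ⊆ P.domain :=
  fun _ hx => mem_domain_iff.2 ⟨T, hT, hx⟩

lemma isCompact_hull (T : Finset (EuclideanSpace ℝ (Fin d))) : IsCompact (hull T) :=
  T.finite_toSet.isCompact_convexHull ℝ

lemma isCompact_starSet : IsCompact (P.starSet s k) :=
  (simplices_finite.subset star_subset_simplices).isCompact_biUnion fun T _ => isCompact_hull T

lemma starSet_subset_domain : P.starSet s k ⊆ P.domain :=
  iUnion₂_subset fun _ hT => hull_subset_domain (star_subset_simplices hT)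

lemma isCompact_domain : IsCompact P.domain := by
  rw [domain_eq_biUnion]
  exact simplices_finite.isCompact_biUnion fun T _ => isCompact_hull T

lemma ae_exists_mem_interior_hull :
    ∀ᵐ x ∂volume.restrict P.domain, ∃ T ∈ P.simplices, x ∈ interior (hull T) := by
  rw [ae_restrict_iff' isCompact_domain.measurableSet]
  have notMem_frontier : ∀ᵐ x : EuclideanSpace ℝ (Fin d), ∀ T ∈ P.simplices,
      x ∉ frontier (hull T) := by
    rw [ae_ball_iff simplices_finite.countable]
    exact fun T _ =>
      measure_eq_zero_iff_ae_notMem.1 ((convex_convexHull ℝ _).addHaar_frontier volume)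
  filter_upwards [notMem_frontier] with x hx hx_domain
  obtain ⟨T, hT, hxT⟩ := mem_domain_iff.1 hx_domain
  exact ⟨T, hT, by_contra fun hx_int => hx T hT ⟨subset_closure hxT, hx_int⟩⟩

lemma domain_ae_eq_biUnion_interior :
    P.domain =ᵐ[volume] ⋃ T ∈ P.simplices, interior (hull T) := by
  refine Filter.eventuallyLE_antisymm_iff.2 ⟨?_, ?_⟩
  · have h := P.ae_exists_mem_interior_hull
    rw [ae_restrict_iff' isCompact_domain.measurableSet] at h
    filter_upwards [h] with x hx hx_domain
    obtain ⟨T, hT, hxT⟩ := hx hx_domain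
    exact mem_biUnion hT hxT
  · exact (iUnion₂_subset fun T hT =>
      interior_subset.trans (hull_subset_domain hT)).eventuallyLE

lemma eventually_exists_hull (x : EuclideanSpace ℝ (Fin d)) :
    ∀ᶠ y in nhds x, y ∈ P.domain → ∃ T ∈ P.simplices, x ∈ hull T ∧ y ∈ hull T := by
  have far_simplices : ∀ᶠ y in nhds x, ∀ T ∈ P.simplices, x ∉ hull T → y ∉ hull T := by
    rw [Filter.eventually_all_finite simplices_finite]
    intro T _
    by_cases hx : x ∈ hull T
    · exact .of_forall fun _ hx' => absurd hx hx'
    · filter_upwards [(isCompact_hull T).isClosed.isOpen_compl.mem_nhds hx] with y hy _ using hy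
  filter_upwards [far_simplices] with y hy hy_domain
  obtain ⟨T, hT, hyT⟩ := mem_domain_iff.1 hy_domain
  exact ⟨T, hT, by_contra fun hx => hy T hT hx hyT, hyT⟩

/-! ### Mesh size and inscribed balls -/

lemma dist_le_meshSize (hT : T ∈ P.simplices) (hx : x ∈ hull T) (hy : y ∈ hull T) :
    dist x y ≤ P.meshSize :=
  (Metric.dist_le_diam_of_mem (isCompact_hull T).isBounded hx hy).trans
    (le_csSup (simplices_finite.image _).bddAbove (mem_image_of_mem _ hT))

lemma meshSize_pos (hd : 1 ≤ d) (hT : T ∈ P.simplices) : 0 < P.meshSize := by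
  obtain ⟨x, hx, y, hy, hxy⟩ := Finset.one_lt_card.1 (by rw [hT.2]; omega : 1 < T.card)
  exact (dist_pos.2 hxy).trans_le
    (dist_le_meshSize hT (subset_convexHull ℝ _ hx) (subset_convexHull ℝ _ hy))

lemma zero_mem_inradius_set (hT : T.Nonempty) :
    (0 : ℝ) ∈ {ρ : ℝ | ∃ x, Metric.closedBall x ρ ⊆ hull T} := by
  obtain ⟨q, hq⟩ := hT
  exact ⟨q, by simpa using subset_convexHull ℝ (T : Set (EuclideanSpace ℝ (Fin d))) hq⟩

lemma QuasiUniform.inradius_pos {β : ℝ} (h : P.QuasiUniform β) (hd : 1 ≤ d)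
    (hT : T ∈ P.simplices) : 0 < β ∧ 0 < inradius T := by
  have inradius_nonneg : 0 ≤ inradius T :=
    Real.sSup_nonneg' ⟨0, zero_mem_inradius_set (nonempty_of_mem_simplices hT), le_rfl⟩
  have mul_pos : 0 < β * inradius T := (meshSize_pos hd hT).trans_le (h T hT)
  have beta_pos : 0 < β := pos_of_mul_pos_left mul_pos inradius_nonneg
  exact ⟨beta_pos, pos_of_mul_pos_right mul_pos beta_pos.le⟩

lemma QuasiUniform.exists_closedBall_subset {β : ℝ} (h : P.QuasiUniform β) (hd : 1 ≤ d)
    (hT : T ∈ P.simplices) :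
    ∃ c, ∃ ρ > 0, Metric.closedBall c ρ ⊆ hull T ∧ P.meshSize ≤ 2 * β * ρ := by
  obtain ⟨beta_pos, inradius_pos⟩ := h.inradius_pos hd hT
  obtain ⟨ρ, ⟨c, hc⟩, hρ⟩ := exists_lt_of_lt_csSup
    ⟨0, zero_mem_inradius_set (nonempty_of_mem_simplices hT)⟩ (half_lt_self inradius_pos)
  refine ⟨c, ρ, (half_pos inradius_pos).trans hρ, hc, (h T hT).trans ?_⟩
  rw [mul_comm 2 β, mul_assoc]
  exact mul_le_mul_of_nonneg_left ((div_lt_iff₀' two_pos).1 hρ).le beta_pos.le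

end SimplicialPartition

/-! ### Gradients as elements of `L²` -/

section Gradient

variable {E : Type*} [NormedAddCommGroup E] [InnerProductSpace ℝ E] [CompleteSpace E]
  {f g : E → ℝ} {x : E}

lemma gradient_add (hf : DifferentiableAt ℝ f x) (hg : DifferentiableAt ℝ g x) :
    gradient (f + g) x = gradient f x + gradient g x := by
  simp only [gradient, fderiv_add hf hg, map_add]

lemma gradient_const_smul (a : ℝ) (hf : DifferentiableAt ℝ f x) :
    gradient (a • f) x = a • gradient f x := by
  simp only [gradient, fderiv_const_smul hf a, map_smulₛₗ, conj_trivial]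

lemma gradient_comp_add_smul {c : E} {ρ : ℝ} (hf : DifferentiableAt ℝ f (c + ρ • x)) :
    gradient (fun z => f (c + ρ • z)) x = ρ • gradient f (c + ρ • x) := by
  have affine_deriv : HasFDerivAt (fun z => c + ρ • z) (ρ • ContinuousLinearMap.id ℝ E) x :=
    ((hasFDerivAt_id x).const_smul ρ).const_add c
  refine HasGradientAt.gradient (hasGradientAt_iff_hasFDerivAt.2 ?_)
  refine (hf.hasGradientAt.hasFDerivAt.comp x affine_deriv).congr_fderiv ?_
  ext y
  simp

lemma gradient_eq_zero_of_eqOn_const {s : Set E} {a : ℝ} (hf : ∀ y ∈ s, f y = a)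
    (hx : x ∈ interior s) : gradient f x = 0 := by
  have locally_const : f =ᶠ[nhds x] fun _ => a :=
    Filter.mem_of_superset (mem_interior_iff_mem_nhds.1 hx) hf
  rw [locally_const.gradient_eq, gradient_fun_const]

lemma continuous_gradient (hf : ContDiff ℝ 1 f) : Continuous (gradient f) :=
  (LinearIsometryEquiv.continuous _).comp (hf.continuous_fderiv one_ne_zero)

variable [MeasurableSpace E] {μ : Measure E}

variable (μ) in
/-- The functions that are differentiable almost everywhere and whose classical gradient is square
integrable: a space containing all splines, on which the gradient is a linear map to `L²`. -/
def gradientDomain : Submodule ℝ (E → ℝ) where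
  carrier := {u | (∀ᵐ x ∂μ, DifferentiableAt ℝ u x) ∧ MemLp (gradient u) 2 μ}
  zero_mem' := by
    have gradient_zero : gradient (0 : E → ℝ) = 0 := funext fun x => gradient_fun_const x 0
    exact ⟨.of_forall fun _ => differentiableAt_const 0, gradient_zero ▸ MemLp.zero⟩
  add_mem' := by
    rintro u v ⟨hu, hu₂⟩ ⟨hv, hv₂⟩
    refine ⟨by filter_upwards [hu, hv] with x hux hvx using hux.add hvx,
      (hu₂.add hv₂).ae_eq ?_⟩
    filter_upwards [hu, hv] with x hux hvx using (gradient_add hux hvx).symm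
  smul_mem' := by
    rintro a u ⟨hu, hu₂⟩
    refine ⟨by filter_upwards [hu] with x hux using hux.const_smul a,
      (hu₂.const_smul a).ae_eq ?_⟩
    filter_upwards [hu] with x hux using (gradient_const_smul a hux).symm

variable (μ) in
/-- The gradient as a linear map to `L²(μ)`. -/
def gradientL2 : gradientDomain μ →ₗ[ℝ] Lp E 2 μ where
  toFun u := u.2.2.toLp
  map_add' u v := by
    rw [← MemLp.toLp_add]
    refine MemLp.toLp_congr _ _ ?_
    filter_upwards [u.2.1, v.2.1] with x hux hvx using gradient_add hux hvx
  map_smul' a u := by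
    rw [RingHom.id_apply, ← MemLp.toLp_const_smul]
    refine MemLp.toLp_congr _ _ ?_
    filter_upwards [u.2.1] with x hux using gradient_const_smul a hux

lemma inner_gradientL2 (u v : gradientDomain μ) :
    inner ℝ (gradientL2 μ u) (gradientL2 μ v) =
      ∫ x, inner ℝ (gradient u.1 x) (gradient v.1 x) ∂μ := by
  rw [L2.inner_def]
  refine integral_congr_ae ?_
  filter_upwards [u.2.2.coeFn_toLp, v.2.2.coeFn_toLp] with x hux hvx
  exact congrArg₂ _ hux hvx

lemma norm_gradientL2_sq (u : gradientDomain μ) :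
    ‖gradientL2 μ u‖ ^ 2 = ∫ x, ‖gradient u.1 x‖ ^ 2 ∂μ := by
  simp only [← real_inner_self_eq_norm_sq, inner_gradientL2]

lemma inner_gradientL2_eq_zero {u v : gradientDomain μ}
    (h : ∀ᵐ x ∂μ, gradient u.1 x = 0 ∨ gradient v.1 x = 0) :
    inner ℝ (gradientL2 μ u) (gradientL2 μ v) = 0 := by
  rw [inner_gradientL2]
  refine integral_eq_zero_of_ae ?_
  filter_upwards [h] with x hx
  rcases hx with hx | hx <;> simp [hx]

variable [BorelSpace E] [IsFiniteMeasureOnCompacts μ] [ProperSpace E] {s : Set E}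

lemma mem_gradientDomain_of_contDiff (hf : ContDiff ℝ 1 f) (hs : Bornology.IsBounded s) :
    f ∈ gradientDomain (μ.restrict s) := by
  refine ⟨.of_forall fun x => hf.differentiable one_ne_zero x, ?_⟩
  have hcont := continuous_gradient hf
  have hint : IntegrableOn (fun x => ‖gradient f x‖ ^ 2) s μ :=
    ((hcont.norm.pow 2).continuousOn.integrableOn_compact hs.isCompact_closure).mono_set
      subset_closure
  exact (memLp_two_iff_integrable_sq_norm hcont.aestronglyMeasurable).2 hint

lemma eq_of_setIntegral_gradient_eq_zero [μ.IsOpenPosMeasure] (hf : ContDiff ℝ 1 f)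
    (hs : IsOpen s) (hconv : Convex ℝ s) (hb : Bornology.IsBounded s)
    (h : ∫ x in s, ‖gradient f x‖ ^ 2 ∂μ = 0) {y : E} (hx : x ∈ s) (hy : y ∈ s) : f x = f y := by
  have hcont : Continuous fun x => ‖gradient f x‖ ^ 2 := (continuous_gradient hf).norm.pow 2
  have hint : IntegrableOn (fun x => ‖gradient f x‖ ^ 2) s μ :=
    (hcont.continuousOn.integrableOn_compact hb.isCompact_closure).mono_set subset_closure
  have gradient_zero : EqOn (fun x => ‖gradient f x‖ ^ 2) 0 s :=
    Measure.eqOn_open_of_ae_eq ((integral_eq_zero_iff_of_nonneg (fun _ => sq_nonneg _) hint).1 h)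
      hs hcont.continuousOn continuousOn_const
  refine hs.is_const_of_fderiv_eq_zero hconv.isPreconnected
    (hf.differentiable one_ne_zero).differentiableOn (fun z hz => ?_) hx hy
  have hz_zero : gradient f z = 0 := by simpa using gradient_zero hz
  rw [← toDual_gradient, hz_zero, map_zero, Pi.zero_apply]

end Gradient

lemma setIntegral_ball_comp_add_smul {E F : Type*} [NormedAddCommGroup E] [NormedSpace ℝ E]
    [FiniteDimensional ℝ E] [MeasurableSpace E] [BorelSpace E] [NormedAddCommGroup F]
    [NormedSpace ℝ F] (μ : Measure E) [μ.IsAddHaarMeasure] (f : E → F) (c : E) {ρ : ℝ}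
    (hρ : 0 < ρ) :
    ∫ z in Metric.ball 0 1, f (c + ρ • z) ∂μ =
      (ρ ^ Module.finrank ℝ E)⁻¹ • ∫ y in Metric.ball c ρ, f y ∂μ := by
  have translate := (measurePreserving_add_left μ c).setIntegral_preimage_emb
    (measurableEmbedding_addLeft c) f (Metric.ball c ρ)
  have ball_preimage : (fun y => c + y) ⁻¹' Metric.ball c ρ = Metric.ball 0 ρ := by
    ext y
    simp
  rw [Measure.setIntegral_comp_smul_of_pos μ (fun y => f (c + y)) _ hρ, smul_unitBall_of_pos hρ,
    ← translate, ball_preimage]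

lemma exists_norm_le_mul_norm_of_ker_le_ker {𝕜 V F G : Type*} [NontriviallyNormedField 𝕜]
    [CompleteSpace 𝕜] [AddCommGroup V] [Module 𝕜 V] [FiniteDimensional 𝕜 V]
    [NormedAddCommGroup F] [NormedSpace 𝕜 F] [NormedAddCommGroup G] [NormedSpace 𝕜 G]
    (L : V →ₗ[𝕜] F) (e : V →ₗ[𝕜] G) (h : L.ker ≤ e.ker) :
    ∃ C, ∀ v, ‖e v‖ ≤ C * ‖L v‖ := by
  let e' : L.range →ₗ[𝕜] G := L.ker.liftQ e h ∘ₗ L.quotKerEquivRange.symm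
  have he' : ∀ v, e' (L.rangeRestrict v) = e v := fun v => by
    have : L.quotKerEquivRange.symm (L.rangeRestrict v) = L.ker.mkQ v :=
      L.quotKerEquivRange.symm_apply_eq.2 rfl
    simp only [e', LinearMap.comp_apply, LinearEquiv.coe_coe, this, Submodule.mkQ_apply,
      Submodule.liftQ_apply]
  refine ⟨‖e'.toContinuousLinearMap‖, fun v => ?_⟩
  rw [← he' v]
  exact e'.toContinuousLinearMap.le_opNorm (L.rangeRestrict v)

/-! ### The inverse inequality for polynomials -/

section Polynomial

variable {ι : Type*}

/-- The linear map that sends a polynomial to the function it defines on `ℝ^ι`. -/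
def polyFun : MvPolynomial ι ℝ →ₗ[ℝ] (EuclideanSpace ℝ ι → ℝ) :=
  LinearMap.pi fun x => (MvPolynomial.aeval fun i => x i).toLinearMap

variable {p : MvPolynomial ι ℝ} {c x : EuclideanSpace ℝ ι} {ρ : ℝ}

lemma polyFun_apply : polyFun p x = MvPolynomial.eval (fun i => x i) p := rfl

lemma totalDegree_bind₁_le {σ τ R : Type*} [CommSemiring R] (p : MvPolynomial σ R)
    {f : σ → MvPolynomial τ R} (hf : ∀ i, (f i).totalDegree ≤ 1) :
    (MvPolynomial.bind₁ f p).totalDegree ≤ p.totalDegree := by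
  rw [MvPolynomial.bind₁, MvPolynomial.aeval_def, MvPolynomial.eval₂_eq]
  refine MvPolynomial.totalDegree_finsetSum_le fun α hα => ?_
  rw [← Algebra.smul_def]
  calc _ ≤ (∏ i ∈ α.support, f i ^ α i).totalDegree := MvPolynomial.totalDegree_smul_le _ _
    _ ≤ ∑ i ∈ α.support, (f i ^ α i).totalDegree := MvPolynomial.totalDegree_finsetProd _ _
    _ ≤ ∑ i ∈ α.support, α i := Finset.sum_le_sum fun i _ =>
      (MvPolynomial.totalDegree_pow _ _).trans ((Nat.mul_le_mul_left _ (hf i)).trans_eq (mul_one _))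
    _ ≤ p.totalDegree := MvPolynomial.le_totalDegree hα

lemma exists_polyFun_eq_comp_add_smul (p : MvPolynomial ι ℝ) (c : EuclideanSpace ℝ ι) (ρ : ℝ) :
    ∃ q : MvPolynomial ι ℝ, q.totalDegree ≤ p.totalDegree ∧
      polyFun q = fun z => polyFun p (c + ρ • z) := by
  refine ⟨MvPolynomial.bind₁
    (fun i => MvPolynomial.C (c i) + MvPolynomial.C ρ * MvPolynomial.X i) p,
    totalDegree_bind₁_le p fun i => ?_, funext fun z => ?_⟩
  · refine (MvPolynomial.totalDegree_add _ _).trans (max_le (by simp) ?_)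
    exact (MvPolynomial.totalDegree_mul _ _).trans (by simp)
  · simp only [polyFun_apply, MvPolynomial.eval, MvPolynomial.eval₂Hom_bind₁]
    congr 2
    ext i
    simp

lemma eq_zero_of_eventually_polyFun_eq_zero [Finite ι] (h : ∀ᶠ x in nhds c, polyFun p x = 0) :
    p = 0 := by
  cases nonempty_fintype ι
  have h' : ∀ᶠ y in nhds c.ofLp, polyFun p (WithLp.toLp 2 y) = 0 :=
    (PiLp.continuous_toLp 2 _).continuousAt.eventually h
  obtain ⟨ε, hε, hball⟩ := Metric.eventually_nhds_iff_ball.1 h'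
  refine MvPolynomial.funext_set (fun i => Metric.ball (c i) ε) (fun i => ?_) fun y hy => ?_
  · rw [Real.ball_eq_Ioo]
    exact Ioo_infinite (by linarith)
  · rw [map_zero]
    exact hball y (by rwa [ball_pi _ hε])

variable [Fintype ι]

lemma contDiff_polyFun (p : MvPolynomial ι ℝ) : ContDiff ℝ 1 (polyFun p) :=
  contDiffOn_univ.1 ((AnalyticOnNhd.eval_continuousLinearMap' (𝕜 := ℝ) (E := EuclideanSpace ℝ ι)
    (fun i => EuclideanSpace.proj i) p).contDiffOn uniqueDiffOn_univ)

lemma exists_sq_sub_le_mul_setIntegral_gradient {s K : Set (EuclideanSpace ℝ ι)} (n : ℕ)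
    (hs : IsOpen s) (hconv : Convex ℝ s) (hb : Bornology.IsBounded s) (hc : c ∈ s)
    (hK : IsCompact K) :
    ∃ C, 0 ≤ C ∧ ∀ p : MvPolynomial ι ℝ, p.totalDegree ≤ n → ∀ x ∈ K,
      (polyFun p x - polyFun p c) ^ 2 ≤ C * ∫ y in s, ‖gradient (polyFun p) y‖ ^ 2 := by
  let V := MvPolynomial.restrictTotalDegree ι ℝ n
  have := isCompact_iff_compactSpace.1 hK
  let L : V →ₗ[ℝ] Lp (EuclideanSpace ℝ ι) 2 (volume.restrict s) :=
    gradientL2 _ ∘ₗ (polyFun.codRestrict (gradientDomain (volume.restrict s)) fun p =>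
      mem_gradientDomain_of_contDiff (contDiff_polyFun p) hb) ∘ₗ V.subtype
  let e : V →ₗ[ℝ] C(K, ℝ) :=
    { toFun := fun p => ⟨fun x => polyFun p.1 x - polyFun p.1 c,
        ((contDiff_polyFun p.1).continuous.comp continuous_subtype_val).sub continuous_const⟩
      map_add' := fun p q => by ext; simp; ring
      map_smul' := fun a p => by ext; simp; ring }
  have norm_L_sq (p : V) : ‖L p‖ ^ 2 = ∫ y in s, ‖gradient (polyFun p.1) y‖ ^ 2 :=
    norm_gradientL2_sq _
  have ker_le : L.ker ≤ e.ker := by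
    intro p hp
    have const_on_s : ∀ y ∈ s, polyFun p.1 y = polyFun p.1 c := fun y hy =>
      eq_of_setIntegral_gradient_eq_zero (contDiff_polyFun p.1) hs hconv hb
        (by rw [← norm_L_sq, LinearMap.mem_ker.1 hp, norm_zero, zero_pow two_ne_zero]) hy hc
    have p_eq : p.1 - MvPolynomial.C (polyFun p.1 c) = 0 := by
      refine eq_zero_of_eventually_polyFun_eq_zero (c := c) ?_
      filter_upwards [hs.mem_nhds hc] with y hy
      simp [polyFun_apply, ← const_on_s y hy]
    ext x
    change polyFun p.1 x - polyFun p.1 c = 0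
    simpa [polyFun_apply] using congrArg (fun q => polyFun q x) p_eq
  obtain ⟨C, hbound⟩ := exists_norm_le_mul_norm_of_ker_le_ker L e ker_le
  refine ⟨C ^ 2, sq_nonneg C, fun p hp x hx => ?_⟩
  let p' : V := ⟨p, (MvPolynomial.mem_restrictTotalDegree _ _ _).2 hp⟩
  have h : |polyFun p x - polyFun p c| ≤ C * ‖L p'‖ :=
    ((e p').norm_coe_le_norm ⟨x, hx⟩).trans (hbound p')
  rw [← norm_L_sq p', ← mul_pow]
  exact sq_le_sq' (neg_le_of_abs_le h) (le_of_abs_le h)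

variable (ι) in
lemma exists_sq_sub_mul_pow_le_setIntegral_ball (n : ℕ) (R : ℝ) :
    ∃ C, 0 ≤ C ∧ ∀ p : MvPolynomial ι ℝ, p.totalDegree ≤ n →
      ∀ (c : EuclideanSpace ℝ ι) (ρ : ℝ), 0 < ρ → ∀ x ∈ Metric.closedBall c (R * ρ),
        (polyFun p x - polyFun p c) ^ 2 * ρ ^ Fintype.card ι ≤
          C * ρ ^ 2 * ∫ y in Metric.ball c ρ, ‖gradient (polyFun p) y‖ ^ 2 := by
  obtain ⟨C, hC, unit_bound⟩ := exists_sq_sub_le_mul_setIntegral_gradient (ι := ι) n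
    Metric.isOpen_ball (convex_ball 0 1) Metric.isBounded_ball (Metric.mem_ball_self one_pos)
    (isCompact_closedBall 0 R)
  refine ⟨C, hC, fun p hp c ρ hρ x hx => ?_⟩
  obtain ⟨q, hq, hqp⟩ := exists_polyFun_eq_comp_add_smul p c ρ
  have hx_unit : ρ⁻¹ • (x - c) ∈ Metric.closedBall 0 R := by
    rwa [mem_closedBall_zero_iff, norm_smul, norm_inv, Real.norm_of_nonneg hρ.le,
      inv_mul_le_iff₀ hρ, mul_comm, ← dist_eq_norm]
  have norm_gradient_q (z : EuclideanSpace ℝ ι) :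
      ‖gradient (polyFun q) z‖ ^ 2 = ρ ^ 2 * ‖gradient (polyFun p) (c + ρ • z)‖ ^ 2 := by
    rw [hqp, gradient_comp_add_smul ((contDiff_polyFun p).differentiable one_ne_zero _), norm_smul,
      mul_pow, Real.norm_of_nonneg hρ.le]
  have h := unit_bound q (hq.trans hp) _ hx_unit
  simp only [norm_gradient_q] at h
  simp only [hqp] at h
  rw [smul_inv_smul₀ hρ.ne', add_sub_cancel, smul_zero, add_zero, integral_const_mul,
    setIntegral_ball_comp_add_smul volume (fun y => ‖gradient (polyFun p) y‖ ^ 2) c hρ,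
    finrank_euclideanSpace, smul_eq_mul] at h
  calc _ ≤ C * (ρ ^ 2 * ((ρ ^ Fintype.card ι)⁻¹ *
          ∫ y in Metric.ball c ρ, ‖gradient (polyFun p) y‖ ^ 2)) * ρ ^ Fintype.card ι := by gcongr
    _ = _ := by field_simp

end Polynomial

/-! ### Splines and the gradient map -/

namespace SimplicialPartition

variable {d : ℕ} {P : SimplicialPartition d} {r n : ℕ} {u v : EuclideanSpace ℝ (Fin d) → ℝ}
  {T : Finset (EuclideanSpace ℝ (Fin d))} {x : EuclideanSpace ℝ (Fin d)}

lemma eventuallyEq_of_eqOn_hull (h : EqOn u v (hull T)) (hx : x ∈ interior (hull T)) :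
    u =ᶠ[nhds x] v :=
  h.eventuallyEq_of_mem (mem_interior_iff_mem_nhds.1 hx)

lemma IsSpline.exists_polyFun (hu : P.IsSpline r n u) (hT : T ∈ P.simplices) :
    ∃ p : MvPolynomial (Fin d) ℝ, p.totalDegree ≤ n ∧ EqOn u (polyFun p) (hull T) :=
  hu.2.2 T hT

lemma IsSpline.differentiableAt (hu : P.IsSpline r n u) (hT : T ∈ P.simplices)
    (hx : x ∈ interior (hull T)) : DifferentiableAt ℝ u x := by
  obtain ⟨p, -, hup⟩ := hu.exists_polyFun hT
  exact ((contDiff_polyFun p).differentiable one_ne_zero x).congr_of_eventuallyEq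
    (eventuallyEq_of_eqOn_hull hup hx)

lemma IsSpline.integrableOn_sq_norm_gradient (hu : P.IsSpline r n u) :
    IntegrableOn (fun x => ‖gradient u x‖ ^ 2) P.domain := by
  rw [IntegrableOn, Measure.restrict_congr_set P.domain_ae_eq_biUnion_interior, ← IntegrableOn,
    integrableOn_finite_biUnion simplices_finite]
  intro T hT
  obtain ⟨p, -, hup⟩ := hu.exists_polyFun hT
  have polynomial_integrable : IntegrableOn (fun x => ‖gradient (polyFun p) x‖ ^ 2) (hull T) :=
    ((continuous_gradient (contDiff_polyFun p)).norm.pow 2).continuousOn.integrableOn_compact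
      (isCompact_hull T)
  refine (polynomial_integrable.mono_set interior_subset).congr_fun (fun x hx => ?_)
    isOpen_interior.measurableSet
  simp only [(eventuallyEq_of_eqOn_hull hup hx).gradient_eq]

variable (P) in
/-- The spline space `S^r_n(△)` as a space of functions on `ℝ^d`. -/
def splineSpace (r n : ℕ) : Submodule ℝ (EuclideanSpace ℝ (Fin d) → ℝ) where
  carrier := {u | P.IsSpline r n u}
  zero_mem' := ⟨continuousOn_const, contDiffOn_const, fun _ _ => ⟨0, by simp, by simp⟩⟩
  add_mem' := by
    rintro u v hu hv
    refine ⟨hu.1.add hv.1, hu.2.1.add hv.2.1, fun T hT => ?_⟩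
    obtain ⟨p, hp, hpu⟩ := hu.2.2 T hT
    obtain ⟨q, hq, hqv⟩ := hv.2.2 T hT
    refine ⟨p + q, (MvPolynomial.totalDegree_add _ _).trans (max_le hp hq), fun x hx => ?_⟩
    rw [Pi.add_apply, hpu x hx, hqv x hx, map_add]
  smul_mem' := by
    rintro a u hu
    refine ⟨hu.1.const_smul a, hu.2.1.const_smul a, fun T hT => ?_⟩
    obtain ⟨p, hp, hpu⟩ := hu.2.2 T hT
    refine ⟨a • p, (MvPolynomial.totalDegree_smul_le _ _).trans hp, fun x hx => ?_⟩
    rw [Pi.smul_apply, hpu x hx, MvPolynomial.smul_eval, smul_eq_mul]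

lemma splineSpace_le_gradientDomain :
    P.splineSpace r n ≤ gradientDomain (volume.restrict P.domain) := by
  intro u hu
  have gradient_measurable : Measurable (gradient u) :=
    (LinearIsometryEquiv.continuous _).measurable.comp (measurable_fderiv ℝ u)
  refine ⟨?_, (memLp_two_iff_integrable_sq_norm gradient_measurable.aestronglyMeasurable).2
    (IsSpline.integrableOn_sq_norm_gradient hu)⟩
  filter_upwards [ae_exists_mem_interior_hull] with x ⟨T, hT, hx⟩
  exact IsSpline.differentiableAt hu hT hx

variable (P r n) in
/-- The gradient of splines as a linear map to `L²(Ω)`; the Dirichlet form is the pull-back of the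
inner product under this map. -/
def splineGradient : P.splineSpace r n →ₗ[ℝ] Lp (EuclideanSpace ℝ (Fin d)) 2
    (volume.restrict P.domain) :=
  gradientL2 _ ∘ₗ Submodule.inclusion splineSpace_le_gradientDomain

lemma norm_splineGradient_sq (u : P.splineSpace r n) :
    ‖P.splineGradient r n u‖ ^ 2 = P.energy u :=
  norm_gradientL2_sq _

lemma splineGradient_congr {u v : P.splineSpace r n} (h : EqOn u.1 v.1 P.domain) :
    P.splineGradient r n u = P.splineGradient r n v := by
  refine MemLp.toLp_congr (splineSpace_le_gradientDomain u.2).2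
    (splineSpace_le_gradientDomain v.2).2 ?_
  filter_upwards [ae_exists_mem_interior_hull] with x ⟨T, hT, hx⟩
  exact (eventuallyEq_of_eqOn_hull (h.mono (hull_subset_domain hT)) hx).gradient_eq

lemma gradient_eq_zero_of_notMem_starSet {s : Finset (EuclideanSpace ℝ (Fin d))} {k : ℕ}
    (hu : ∀ x ∈ P.domain, x ∉ P.starSet s k → u x = 0) (hx : x ∈ interior P.domain)
    (hxs : x ∉ P.starSet s k) : gradient u x = 0 := by
  refine gradient_eq_zero_of_eqOn_const (s := P.domain ∩ (P.starSet s k)ᶜ)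
    (fun y hy => hu y hy.1 hy.2) ?_
  rw [interior_inter, isCompact_starSet.isClosed.isOpen_compl.interior_eq]
  exact ⟨hx, hxs⟩

lemma inner_splineGradient_eq_zero {u v : P.splineSpace r n}
    {s t : Finset (EuclideanSpace ℝ (Fin d))} {j k : ℕ}
    (hu : ∀ x ∈ P.domain, x ∉ P.starSet s j → u.1 x = 0)
    (hv : ∀ x ∈ P.domain, x ∉ P.starSet t k → v.1 x = 0) (ht : t ∈ P.simplices)
    (h : t ∉ P.star s (j + k + 1)) :
    inner ℝ (P.splineGradient r n u) (P.splineGradient r n v) = 0 := by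
  refine inner_gradientL2_eq_zero ?_
  filter_upwards [ae_exists_mem_interior_hull] with x ⟨T, hT, hxT⟩
  have hx : x ∈ interior P.domain := interior_mono (hull_subset_domain hT) hxT
  by_cases hxs : x ∈ P.starSet s j
  · exact .inr (gradient_eq_zero_of_notMem_starSet hv hx fun hxt =>
      h (mem_star_of_mem_starSet_of_mem_starSet ht hxs hxt))
  · exact .inl (gradient_eq_zero_of_notMem_starSet hu hx hxs)

lemma IsSpline.setIntegral_polyFun_le_energy (hu : P.IsSpline r n u) (hT : T ∈ P.simplices)
    {p : MvPolynomial (Fin d) ℝ} (hp : EqOn u (polyFun p) (hull T))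
    {s : Set (EuclideanSpace ℝ (Fin d))} (hs : IsOpen s) (hsT : s ⊆ hull T) :
    ∫ x in s, ‖gradient (polyFun p) x‖ ^ 2 ≤ P.energy u := by
  have gradient_eq : ∀ x ∈ s, ‖gradient (polyFun p) x‖ ^ 2 = ‖gradient u x‖ ^ 2 := fun x hx => by
    rw [(eventuallyEq_of_eqOn_hull hp (interior_maximal hsT hs hx)).gradient_eq]
  rw [setIntegral_congr_fun hs.measurableSet gradient_eq]
  exact setIntegral_mono_set hu.integrableOn_sq_norm_gradient (.of_forall fun _ => sq_nonneg _)
    (hsT.trans (hull_subset_domain hT)).eventuallyLE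

end SimplicialPartition

/-! ### Orthogonality and Riesz families -/

lemma inner_eq_zero_of_forall_norm_le_norm_add_smul {H : Type*} [NormedAddCommGroup H]
    [InnerProductSpace ℝ H] {x y : H} (h : ∀ t : ℝ, ‖x‖ ≤ ‖x + t • y‖) : inner ℝ x y = 0 := by
  have infimum_attained : ‖x - 0‖ = ⨅ w : (ℝ ∙ y), ‖x - w‖ := by
    rw [sub_zero]
    refine le_antisymm (le_ciInf fun ⟨w, hw⟩ => ?_)
      (ciInf_le_of_le ⟨0, forall_mem_range.2 fun _ => norm_nonneg _⟩ 0 (by simp))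
    obtain ⟨t, rfl⟩ := Submodule.mem_span_singleton.1 hw
    simpa [sub_eq_add_neg] using h (-t)
  simpa using ((ℝ ∙ y).norm_eq_iInf_iff_real_inner_eq_zero (zero_mem _)).1 infimum_attained y
    (Submodule.mem_span_singleton_self y)

section RieszFamily

variable {ι H : Type*} [Fintype ι] [NormedAddCommGroup H] [InnerProductSpace ℝ H]
  {b : ι → H} {c : ι → ℝ} {C₁ C₂ : ℝ}

/-- The two-sided Riesz inequalities for a finite family in a (pre-)Hilbert space. -/
def IsRieszFamily (b : ι → H) (C₁ C₂ : ℝ) : Prop :=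
  ∀ c : ι → ℝ, C₁ * ∑ i, c i ^ 2 ≤ ‖∑ i, c i • b i‖ ^ 2 ∧
    ‖∑ i, c i • b i‖ ^ 2 ≤ C₂ * ∑ i, c i ^ 2

namespace IsRieszFamily

lemma sum_finset (hb : IsRieszFamily b C₁ C₂) (c : ι → ℝ) (s : Finset ι) :
    C₁ * ∑ i ∈ s, c i ^ 2 ≤ ‖∑ i ∈ s, c i • b i‖ ^ 2 ∧
      ‖∑ i ∈ s, c i • b i‖ ^ 2 ≤ C₂ * ∑ i ∈ s, c i ^ 2 := by
  classical
  simpa only [ite_smul, zero_smul, Finset.sum_ite_mem, Finset.univ_inter, ite_pow,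
    zero_pow two_ne_zero] using hb fun i => if i ∈ s then c i else 0

lemma sum_sq_le_mul_sum_sq_of_inner_eq_zero (hb : IsRieszFamily b C₁ C₂) (hC₁ : 0 < C₁)
    (hC₂ : 0 ≤ C₂) {s t : Finset ι} (hts : t ⊆ s)
    (hlocal : ∀ i ∉ s, ∀ j ∈ t, inner ℝ (b i) (b j) = 0)
    (horth : ∀ j ∈ t, inner ℝ (∑ i, c i • b i) (b j) = 0) :
    ∑ i ∈ t, c i ^ 2 ≤ C₂ / (C₁ + C₂) * ∑ i ∈ s, c i ^ 2 := by
  classical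
  set inner_part := ∑ i ∈ t, c i • b i with inner_part_def
  set ring_part := ∑ i ∈ s \ t, c i • b i with ring_part_def
  set outer_part := ∑ i ∈ sᶜ, c i • b i with outer_part_def
  have decomposition : outer_part + (ring_part + inner_part) = ∑ i, c i • b i := by
    rw [ring_part_def, inner_part_def, outer_part_def, Finset.sum_sdiff hts,
      Finset.sum_compl_add_sum]
  have outer_orthogonal : inner ℝ outer_part inner_part = 0 := by
    rw [outer_part_def, inner_part_def, sum_inner]
    refine Finset.sum_eq_zero fun i hi => ?_
    rw [inner_sum]
    refine Finset.sum_eq_zero fun j hj => ?_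
    rw [real_inner_smul_left, real_inner_smul_right, hlocal i (Finset.mem_compl.1 hi) j hj,
      mul_zero, mul_zero]
  have total_orthogonal : inner ℝ (∑ i, c i • b i) inner_part = 0 := by
    rw [inner_part_def, inner_sum]
    refine Finset.sum_eq_zero fun j hj => ?_
    rw [real_inner_smul_right, horth j hj, mul_zero]
  have orthogonal : inner ℝ (ring_part + inner_part) inner_part = 0 := by
    rwa [← decomposition, inner_add_left, outer_orthogonal, zero_add] at total_orthogonal
  have norm_le : ‖inner_part‖ ^ 2 ≤ ‖ring_part‖ ^ 2 := by
    have pythagoras := norm_sub_sq_real (ring_part + inner_part) inner_part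
    rw [orthogonal, add_sub_cancel_right] at pythagoras
    nlinarith [sq_nonneg ‖ring_part + inner_part‖]
  have coefficients_le := ((hb.sum_finset c t).1.trans norm_le).trans (hb.sum_finset c (s \ t)).2
  rw [← Finset.sum_sdiff hts, div_mul_eq_mul_div, le_div_iff₀ (by positivity)]
  linarith

lemma sum_sq_le_pow_mul_sum_sq (hb : IsRieszFamily b C₁ C₂) (hC₁ : 0 < C₁) (hC₂ : 0 ≤ C₂)
    {s : ℕ → Finset ι} (hs : Antitone s)
    (hlocal : ∀ m, ∀ i ∉ s m, ∀ j ∈ s (m + 1), inner ℝ (b i) (b j) = 0)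
    (horth : ∀ m, ∀ j ∈ s (m + 1), inner ℝ (∑ i, c i • b i) (b j) = 0) (m : ℕ) :
    ∑ i ∈ s m, c i ^ 2 ≤ (C₂ / (C₁ + C₂)) ^ m * ∑ i, c i ^ 2 := by
  induction m with
  | zero =>
    rw [pow_zero, one_mul]
    exact Finset.sum_le_sum_of_subset_of_nonneg (Finset.subset_univ _) fun i _ _ => sq_nonneg _
  | succ m ih =>
    calc ∑ i ∈ s (m + 1), c i ^ 2
        ≤ C₂ / (C₁ + C₂) * ∑ i ∈ s m, c i ^ 2 :=
          hb.sum_sq_le_mul_sum_sq_of_inner_eq_zero hC₁ hC₂ (hs m.le_succ) (hlocal m) (horth m)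
      _ ≤ C₂ / (C₁ + C₂) * ((C₂ / (C₁ + C₂)) ^ m * ∑ i, c i ^ 2) := by gcongr
      _ = _ := by ring

lemma norm_sum_sq_le_pow_mul_norm_sum_sq (hb : IsRieszFamily b C₁ C₂) (hC₁ : 0 < C₁)
    (hC₂ : 0 ≤ C₂) {s : ℕ → Finset ι} (hs : Antitone s)
    (hlocal : ∀ m, ∀ i ∉ s m, ∀ j ∈ s (m + 1), inner ℝ (b i) (b j) = 0)
    (horth : ∀ m, ∀ j ∈ s (m + 1), inner ℝ (∑ i, c i • b i) (b j) = 0) {m : ℕ} {t : Finset ι}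
    (ht : t ⊆ s m) :
    ‖∑ i ∈ t, c i • b i‖ ^ 2 ≤
      C₂ / C₁ * (C₂ / (C₁ + C₂)) ^ m * ‖∑ i, c i • b i‖ ^ 2 := by
  calc ‖∑ i ∈ t, c i • b i‖ ^ 2
      ≤ C₂ * ∑ i ∈ t, c i ^ 2 := (hb.sum_finset c t).2
    _ ≤ C₂ * ∑ i ∈ s m, c i ^ 2 := by
        gcongr
    _ ≤ C₂ * ((C₂ / (C₁ + C₂)) ^ m * ∑ i, c i ^ 2) := by
        gcongr
        exact hb.sum_sq_le_pow_mul_sum_sq hC₁ hC₂ hs hlocal horth m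
    _ = C₂ / C₁ * (C₂ / (C₁ + C₂)) ^ m * (C₁ * ∑ i, c i ^ 2) := by field_simp
    _ ≤ _ := by
        gcongr
        exact (hb c).1

end IsRieszFamily

end RieszFamily

/-! ### Pointwise bounds by the energy -/

lemma exists_eq_zero_of_forall_mem_nhds {X R : Type*} [TopologicalSpace X] [T2Space X]
    [PreconnectedSpace X] [NoncompactSpace X] [Zero R] {Ω K : Set X} {u : X → R}
    (hK : IsCompact K) (hne : K.Nonempty) (hKΩ : K ⊆ Ω) (hu : ∀ x ∈ frontier Ω, u x = 0)
    (h : ∀ x ∈ K, x ∈ interior Ω → u x ≠ 0 → K ∈ nhds x) : ∃ x ∈ K, u x = 0 := by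
  obtain ⟨x, hx⟩ : (frontier K).Nonempty := by
    rw [nonempty_iff_ne_empty, Ne, ← isClopen_iff_frontier_eq_empty, isClopen_iff]
    rintro (rfl | rfl)
    exacts [hne.ne_empty rfl, noncompact_univ X hK]
  have hxK : x ∈ K := hK.isClosed.frontier_subset hx
  refine ⟨x, hxK, ?_⟩
  by_cases hx_interior : x ∈ interior Ω
  · by_contra hux
    exact hx.2 (mem_interior_iff_mem_nhds.2 (h x hxK hx_interior hux))
  · exact hu x ⟨subset_closure (hKΩ hxK), hx_interior⟩

lemma exists_eq_zero_of_forall_notMem {X R : Type*} [TopologicalSpace X] [T2Space X]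
    [PreconnectedSpace X] [NoncompactSpace X] [Zero R] [TopologicalSpace R] [T1Space R]
    {Ω K : Set X} {u : X → R} (hcont : ContinuousOn u Ω) (hK : IsCompact K) (hne : K.Nonempty)
    (hKΩ : K ⊆ Ω) (hu : ∀ x ∈ frontier Ω, u x = 0) (h : ∀ x ∈ Ω, x ∉ K → u x = 0) :
    ∃ x ∈ K, u x = 0 := by
  refine exists_eq_zero_of_forall_mem_nhds hK hne hKΩ hu fun x _ hx hux => ?_
  have hΩ : Ω ∈ nhds x := mem_interior_iff_mem_nhds.1 hx
  filter_upwards [(hcont.continuousAt hΩ).eventually_ne hux, hΩ] with y hy hyΩ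
  by_contra hyK
  exact hy (h y hyΩ hyK)

namespace SimplicialPartition

variable {d : ℕ} {P : SimplicialPartition d} {r n l k : ℕ} {p v : EuclideanSpace ℝ (Fin d)}
  {s T : Finset (EuclideanSpace ℝ (Fin d))} {u : EuclideanSpace ℝ (Fin d) → ℝ} {δ : ℝ}

lemma exists_sq_sub_mul_pow_le_energy (d n : ℕ) (R : ℝ) : ∃ C, 0 ≤ C ∧
    ∀ (P : SimplicialPartition d) (r : ℕ) (u : EuclideanSpace ℝ (Fin d) → ℝ), P.IsSpline r n u →
      ∀ T ∈ P.simplices, ∀ c ρ, 0 < ρ → Metric.closedBall c ρ ⊆ hull T →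
        ∀ x ∈ hull T, dist x c ≤ R * ρ → (u x - u c) ^ 2 * ρ ^ d ≤ C * ρ ^ 2 * P.energy u := by
  obtain ⟨C, hC, polynomial_bound⟩ := exists_sq_sub_mul_pow_le_setIntegral_ball (Fin d) n R
  refine ⟨C, hC, fun P r u hu T hT c ρ hρ hball x hx hxc => ?_⟩
  obtain ⟨p, hp, hup⟩ := hu.exists_polyFun hT
  have bound := polynomial_bound p hp c ρ hρ x hxc
  rw [Fintype.card_fin, ← hup hx, ← hup (hball (Metric.mem_closedBall_self hρ.le))] at bound
  refine bound.trans ?_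
  gcongr
  exact hu.setIntegral_polyFun_le_energy hT hup Metric.isOpen_ball
    (Metric.ball_subset_closedBall.trans hball)

lemma QuasiUniform.exists_sq_sub_mul_pow_le_energy (d n : ℕ) (β : ℝ) (hd : 2 ≤ d) : ∃ C, 0 ≤ C ∧
    ∀ P : SimplicialPartition d, P.QuasiUniform β → ∀ (r : ℕ) u, P.IsSpline r n u →
      ∀ T ∈ P.simplices, ∀ x ∈ hull T, ∀ y ∈ hull T,
        (u x - u y) ^ 2 * P.meshSize ^ (d - 2) ≤ C * P.energy u := by
  obtain ⟨C, hC, ball_bound⟩ := SimplicialPartition.exists_sq_sub_mul_pow_le_energy d n (2 * β)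
  refine ⟨4 * ((2 * |β|) ^ (d - 2) * C), by positivity, fun P hP r u hu T hT x hx y hy => ?_⟩
  obtain ⟨c, ρ, hρ, hball, hmesh⟩ := hP.exists_closedBall_subset (by lia) hT
  have mesh_pos := meshSize_pos (by lia) hT
  have center_bound (z) (hz : z ∈ hull T) :
      (u z - u c) ^ 2 * P.meshSize ^ (d - 2) ≤ (2 * |β|) ^ (d - 2) * C * P.energy u := by
    have hzc := (dist_le_meshSize hT hz (hball (Metric.mem_closedBall_self hρ.le))).trans hmesh
    have bound := ball_bound P r u hu T hT c ρ hρ hball z hz hzc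
    rw [← pow_sub_mul_pow ρ hd] at bound
    have rescaled_bound : (u z - u c) ^ 2 * ρ ^ (d - 2) ≤ C * P.energy u :=
      le_of_mul_le_mul_right (by linarith) (pow_pos hρ 2)
    calc (u z - u c) ^ 2 * P.meshSize ^ (d - 2)
        ≤ (u z - u c) ^ 2 * (2 * |β| * ρ) ^ (d - 2) := by
          gcongr
          exact hmesh.trans (by gcongr; exact le_abs_self β)
      _ = (2 * |β|) ^ (d - 2) * ((u z - u c) ^ 2 * ρ ^ (d - 2)) := by rw [mul_pow]; ring
      _ ≤ (2 * |β|) ^ (d - 2) * (C * P.energy u) := by gcongr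
      _ = _ := by ring
  have sq_sub_le : (u x - u y) ^ 2 ≤ 2 * (u x - u c) ^ 2 + 2 * (u y - u c) ^ 2 := by
    linarith [sq_nonneg (u x - u c + (u y - u c))]
  calc (u x - u y) ^ 2 * P.meshSize ^ (d - 2)
      ≤ (2 * (u x - u c) ^ 2 + 2 * (u y - u c) ^ 2) * P.meshSize ^ (d - 2) := by gcongr
    _ ≤ _ := by linarith [center_bound x hx, center_bound y hy]

variable (P) in
/-- The oscillation of `u` on every simplex of the partition is at most `δ`. -/
def OscillationLE (u : EuclideanSpace ℝ (Fin d) → ℝ) (δ : ℝ) : Prop :=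
  ∀ T ∈ P.simplices, ∀ x ∈ hull T, ∀ y ∈ hull T, |u x - u y| ≤ δ

lemma QuasiUniform.exists_oscillationLE_sqrt (d n : ℕ) (β : ℝ) (hd : 2 ≤ d) : ∃ C, 0 ≤ C ∧
    ∀ P : SimplicialPartition d, P.QuasiUniform β → ∀ (r : ℕ) u, P.IsSpline r n u →
      ∀ a, P.energy u ≤ a * P.meshSize ^ (d - 2) → P.OscillationLE u √(C * a) := by
  obtain ⟨C, hC, sq_bound⟩ := exists_sq_sub_mul_pow_le_energy d n β hd
  refine ⟨C, hC, fun P hP r u hu a ha T hT x hx y hy => Real.abs_le_sqrt ?_⟩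
  have mesh_pos := meshSize_pos (by lia) hT
  refine le_of_mul_le_mul_right ?_ (pow_pos mesh_pos (d - 2))
  calc (u x - u y) ^ 2 * P.meshSize ^ (d - 2)
      ≤ C * P.energy u := sq_bound P hP r u hu T hT x hx y hy
    _ ≤ C * (a * P.meshSize ^ (d - 2)) := by gcongr
    _ = _ := by ring

lemma OscillationLE.exists_abs_sub_le (hu : P.OscillationLE u δ) (hT : T ∈ P.star s k)
    {y : EuclideanSpace ℝ (Fin d)} (hy : y ∈ hull T) : ∃ q ∈ s, |u q - u y| ≤ k * δ := by
  induction k generalizing T y with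
  | zero => exact hT.elim
  | succ k ih =>
    rcases k with _ | k
    · obtain ⟨hT, q, hqT, hqs⟩ := hT
      exact ⟨q, hqs, by simpa using hu T hT q (subset_convexHull ℝ _ hqT) y hy⟩
    · obtain ⟨hT, T', hT', q, hqT, hqT'⟩ := hT
      obtain ⟨q', hq', bound⟩ := ih hT' (subset_convexHull ℝ _ hqT')
      refine ⟨q', hq', (abs_sub_le _ (u q) _).trans ?_⟩
      push_cast at bound ⊢
      linarith [hu T hT q (subset_convexHull ℝ _ hqT) y hy]

lemma IsSplineZero.abs_le_of_support (hd : 1 ≤ d) (hu : P.IsSplineZero r n u)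
    (hδ : P.OscillationLE u δ) (hT : T ∈ P.simplices) (hk : 1 ≤ k)
    (hsupport : ∀ x ∈ P.domain, x ∉ P.starSet T k → u x = 0) (hv : v ∈ hull T) :
    |u v| ≤ (k + 1) * δ := by
  have : Nonempty (Fin d) := ⟨⟨0, hd⟩⟩
  obtain ⟨x, hx, hux⟩ := exists_eq_zero_of_forall_notMem hu.1.1 isCompact_starSet
    ⟨v, mem_biUnion (mem_star_self hT hk) hv⟩ starSet_subset_domain hu.2 hsupport
  obtain ⟨T', hT', hxT'⟩ := mem_iUnion₂.1 hx
  obtain ⟨q, hq, bound⟩ := hδ.exists_abs_sub_le hT' hxT'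
  rw [hux, sub_zero] at bound
  have hvq := hδ T hT v hv q (subset_convexHull ℝ _ hq)
  linarith [abs_sub_abs_le_abs_sub (u v) (u q)]

/-! ### The variational characterization -/

variable {S G : EuclideanSpace ℝ (Fin d) → ℝ}

lemma HasHatBoundaryValues.eq_on_frontier (hS : P.HasHatBoundaryValues p S)
    (hG : P.HasHatBoundaryValues p G) {x : EuclideanSpace ℝ (Fin d)} (hx : x ∈ frontier P.domain) :
    S x = G x := by
  obtain ⟨T, hT, hxT⟩ := mem_domain_iff.1 (P.isCompact_domain.isClosed.frontier_subset hx)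
  obtain ⟨w, hw, hw_sum, rfl⟩ := Finset.mem_convexHull'.1 hxT
  have hSx := hS T hT.1 w hw hw_sum hx
  have hGx := hG T hT.1 w hw hw_sum hx
  by_cases hp : p ∈ T
  · rw [hSx.1 hp, hGx.1 hp]
  · rw [hSx.2 hp, hGx.2 hp]

lemma HasHatBoundaryValues.apply_self (hu : P.HasHatBoundaryValues p u)
    (hp : p ∈ P.complex.vertices) (hpf : p ∈ frontier P.domain) : u p = 1 := by
  simpa using (hu {p} hp (fun _ => 1) (by simp) (by simp) (by simpa using hpf)).1 (by simp)

lemma IsBoundaryGBCSpline.inner_splineGradient_eq_zero {S φ : P.splineSpace r n}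
    (hS : P.IsBoundaryGBCSpline r n p S) (hφ : ∀ x ∈ frontier P.domain, φ.1 x = 0) :
    inner ℝ (P.splineGradient r n S) (P.splineGradient r n φ) = 0 := by
  refine inner_eq_zero_of_forall_norm_le_norm_add_smul fun t => ?_
  have energy_le := hS.2.2 (S + t • φ : P.splineSpace r n) (S + t • φ : P.splineSpace r n).2 (by
    intro s hs w hw hw_sum hx
    simpa [hφ _ hx] using hS.2.1 s hs w hw hw_sum hx)
  rw [← norm_splineGradient_sq, ← norm_splineGradient_sq, map_add, map_smul] at energy_le
  exact le_of_sq_le_sq energy_le (norm_nonneg _)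

lemma IsBoundaryGBCSpline.norm_splineGradient_sub_le {S G : P.splineSpace r n}
    (hS : P.IsBoundaryGBCSpline r n p S) (hG : P.HasHatBoundaryValues p G) :
    ‖P.splineGradient r n (S - G)‖ ≤ ‖P.splineGradient r n G‖ := by
  have orthogonal := hS.inner_splineGradient_eq_zero (φ := S - G) fun x hx =>
    sub_eq_zero.2 (hS.2.1.eq_on_frontier hG hx)
  have pythagoras := norm_sub_sq_eq_norm_sq_add_norm_sq_real orthogonal
  rw [← map_sub, sub_sub_cancel] at pythagoras
  nlinarith [norm_nonneg (P.splineGradient r n G), norm_nonneg (P.splineGradient r n (S - G)),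
    norm_nonneg (P.splineGradient r n S)]

end SimplicialPartition

/-! ### Exponential decay of boundary GBC splines -/

lemma exists_pow_eq_of_lt_one {θ : ℝ} (hθ : 0 < θ) (hθ_lt : θ < 1) {N : ℕ} (hN : N ≠ 0) :
    ∃ σ : ℝ, 0 < σ ∧ σ < 1 ∧ σ ^ N = θ :=
  ⟨θ ^ (N⁻¹ : ℝ), Real.rpow_pos_of_pos hθ _, Real.rpow_lt_one hθ.le hθ_lt (by positivity),
    Real.rpow_inv_natCast_pow hθ.le hN⟩

namespace SimplicialPartition

variable {d : ℕ} {P : SimplicialPartition d} {r n l k m : ℕ} {κ β A : ℝ}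
  {p v : EuclideanSpace ℝ (Fin d)} {T : Finset (EuclideanSpace ℝ (Fin d))}

/-- The data of an `l`-local Riesz basis of `S^r_n(△) ∩ H^1_0(Ω)`; the Riesz inequalities are stated
for the gradients in `L²(Ω)`, with upper constant exactly `κ` times the lower one. -/
structure LocalRieszBasis (P : SimplicialPartition d) (r n l : ℕ) (κ : ℝ) where
  size : ℕ
  basis : Fin size → P.splineSpace r n
  center : Fin size → Finset (EuclideanSpace ℝ (Fin d))
  lower : ℝ
  lower_pos : 0 < lower
  eq_zero_on_frontier : ∀ ξ, ∀ x ∈ frontier P.domain, (basis ξ).1 x = 0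
  center_mem : ∀ ξ, center ξ ∈ P.simplices
  eq_zero_of_notMem : ∀ ξ, ∀ x ∈ P.domain, x ∉ P.starSet (center ξ) l → (basis ξ).1 x = 0
  exists_coeff : ∀ u : P.splineSpace r n, (∀ x ∈ frontier P.domain, u.1 x = 0) →
    ∃ c : Fin size → ℝ, EqOn u.1 (∑ ξ, c ξ • basis ξ : P.splineSpace r n).1 P.domain
  isRieszFamily :
    IsRieszFamily (fun ξ => P.splineGradient r n (basis ξ)) lower (κ * lower)

lemma HasLocalRieszBasis.nonempty_localRieszBasis (h : P.HasLocalRieszBasis r n l κ) {κ' : ℝ}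
    (hκ : κ ≤ κ') : Nonempty (P.LocalRieszBasis r n l κ') := by
  obtain ⟨N, B, τ, C₁, C₂, hC₁, hC₂, hB, hτ, hspan, hriesz⟩ := h
  set basis : Fin N → P.splineSpace r n := fun ξ => ⟨B ξ, (hB ξ).1⟩
  have coe_sum (c : Fin N → ℝ) :
      (∑ ξ, c ξ • basis ξ : P.splineSpace r n).1 = fun x => ∑ ξ, c ξ * B ξ x := by
    ext x
    simp [basis, Finset.sum_apply]
  refine ⟨⟨N, basis, τ, C₁, hC₁, fun ξ => (hB ξ).2, fun ξ => (hτ ξ).1, fun ξ => (hτ ξ).2,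
    fun u hu => ?_, fun c => ?_⟩⟩
  · obtain ⟨c, hc⟩ := hspan u.1 ⟨u.2, hu⟩
    exact ⟨c, fun x hx => by rw [coe_sum, hc x hx]⟩
  · simp only [← map_smul, ← map_sum, norm_splineGradient_sq, coe_sum]
    refine ⟨(hriesz c).1, (hriesz c).2.trans ?_⟩
    gcongr
    exact hC₂.trans (by gcongr)

namespace LocalRieszBasis

variable (b : P.LocalRieszBasis r n l κ)

open Classical in
/-- The indices of the basis functions centred outside the `m`-th layer of simplices around `p`. The
layers have width `2 l + 1`, so that basis functions two layers apart have disjoint supports up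
to a null set. -/
def farIndices (p : EuclideanSpace ℝ (Fin d)) (m : ℕ) : Finset (Fin b.size) :=
  {ξ | b.center ξ ∉ P.star {p} ((2 * l + 1) * m)}

lemma mem_farIndices {ξ : Fin b.size} :
    ξ ∈ b.farIndices p m ↔ b.center ξ ∉ P.star {p} ((2 * l + 1) * m) := by
  simp [farIndices]

lemma antitone_farIndices : Antitone (b.farIndices p) := by
  intro i j hij ξ hξ
  rw [mem_farIndices] at hξ ⊢
  exact fun h => hξ (star_mono (by gcongr) h)

lemma inner_eq_zero_of_notMem_farIndices {ξ η : Fin b.size} (hξ : ξ ∉ b.farIndices p m)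
    (hη : η ∈ b.farIndices p (m + 1)) :
    inner ℝ (P.splineGradient r n (b.basis ξ)) (P.splineGradient r n (b.basis η)) = 0 := by
  rw [mem_farIndices] at hξ hη
  refine inner_splineGradient_eq_zero (b.eq_zero_of_notMem ξ) (b.eq_zero_of_notMem η)
    (b.center_mem η) fun h => hη ?_
  convert star_trans (not_not.1 hξ) h using 2
  ring

lemma inner_sum_eq_zero_of_mem_farIndices {S G : P.splineSpace r n}
    (hS : P.IsBoundaryGBCSpline r n p S)
    (hGl : ∀ x ∈ P.domain, x ∉ P.starSet {p} l → G.1 x = 0) {c : Fin b.size → ℝ}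
    (hc : EqOn (S - G : P.splineSpace r n).1 (∑ ξ, c ξ • b.basis ξ : P.splineSpace r n).1 P.domain)
    {η : Fin b.size} (hη : η ∈ b.farIndices p (m + 1)) :
    inner ℝ (∑ ξ, c ξ • P.splineGradient r n (b.basis ξ))
      (P.splineGradient r n (b.basis η)) = 0 := by
  simp only [← map_smul, ← map_sum]
  rw [← splineGradient_congr hc, map_sub, inner_sub_left,
    hS.inner_splineGradient_eq_zero (b.eq_zero_on_frontier η), zero_sub, neg_eq_zero]
  refine inner_splineGradient_eq_zero hGl (b.eq_zero_of_notMem η) (b.center_mem η) fun h => ?_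
  rw [mem_farIndices] at hη
  exact hη (star_mono (by rw [mul_add]; lia) h)

open Classical in
/-- The indices of the basis functions that do not vanish at `v`. -/
def indicesAt (v : EuclideanSpace ℝ (Fin d)) : Finset (Fin b.size) :=
  {ξ | (b.basis ξ).1 v ≠ 0}

lemma center_mem_star_of_mem_indicesAt (hT : T ∈ P.simplices) (hv : v ∈ hull T) {ξ : Fin b.size}
    (hξ : ξ ∈ b.indicesAt v) : b.center ξ ∈ P.star T (l + 1) := by
  refine star_symm (b.center_mem ξ) (mem_star_of_mem_starSet hT hv ?_)
  by_contra hvξ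
  exact (Finset.mem_filter.1 hξ).2 (b.eq_zero_of_notMem ξ v (hull_subset_domain hT hv) hvξ)

lemma indicesAt_subset_farIndices (hT : T ∈ P.simplices) (hv : v ∈ hull T)
    (hm : T ∈ P.star {p} ((2 * l + 1) * m + (l + 1)) → m = 0) :
    b.indicesAt v ⊆ b.farIndices p m := by
  intro ξ hξ
  rw [mem_farIndices]
  intro hξp
  obtain rfl := hm (star_trans hξp (star_symm hT (b.center_mem_star_of_mem_indicesAt hT hv hξ)))
  exact hξp

lemma sum_indicesAt_apply (c : Fin b.size → ℝ) (v : EuclideanSpace ℝ (Fin d)) :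
    (∑ ξ ∈ b.indicesAt v, c ξ • b.basis ξ : P.splineSpace r n).1 v =
      (∑ ξ, c ξ • b.basis ξ : P.splineSpace r n).1 v := by
  simp only [Submodule.coe_sum, Submodule.coe_smul, Finset.sum_apply, Pi.smul_apply]
  refine Finset.sum_subset (Finset.subset_univ _) fun ξ _ hξ => ?_
  have basis_apply : (b.basis ξ).1 v = 0 := by simpa [indicesAt] using hξ
  rw [basis_apply, smul_zero]

lemma sum_indicesAt_eq_zero_of_notMem (c : Fin b.size → ℝ) (hT : T ∈ P.simplices)
    (hv : v ∈ hull T) {x : EuclideanSpace ℝ (Fin d)} (hx : x ∈ P.domain)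
    (hxT : x ∉ P.starSet T (2 * l + 1)) :
    (∑ ξ ∈ b.indicesAt v, c ξ • b.basis ξ : P.splineSpace r n).1 x = 0 := by
  simp only [Submodule.coe_sum, Submodule.coe_smul, Finset.sum_apply, Pi.smul_apply]
  refine Finset.sum_eq_zero fun ξ hξ => ?_
  rw [b.eq_zero_of_notMem ξ x hx, smul_zero]
  intro hxξ
  obtain ⟨T', hT', hxT'⟩ := mem_iUnion₂.1 hxξ
  refine hxT (mem_biUnion ?_ hxT')
  convert star_trans (b.center_mem_star_of_mem_indicesAt hT hv hξ) hT' using 2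
  ring

end LocalRieszBasis

lemma LocalRieszBasis.exists_near_part (b : P.LocalRieszBasis r n l κ) (hκ : 0 ≤ κ)
    {S G : P.splineSpace r n} (hS : P.IsBoundaryGBCSpline r n p S)
    (hG : P.HasHatBoundaryValues p G) (hGl : ∀ x ∈ P.domain, x ∉ P.starSet {p} l → G.1 x = 0)
    (hT : T ∈ P.simplices) (hv : v ∈ hull T)
    (hm : T ∈ P.star {p} ((2 * l + 1) * m + (l + 1)) → m = 0) :
    ∃ u, P.IsSplineZero r n u ∧ S.1 v = G.1 v + u v ∧
      (∀ x ∈ P.domain, x ∉ P.starSet T (2 * l + 1) → u x = 0) ∧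
      P.energy u ≤ κ * (κ / (1 + κ)) ^ m * P.energy G := by
  obtain ⟨c, hc⟩ := b.exists_coeff (S - G) fun x hx =>
    sub_eq_zero.2 (hS.2.1.eq_on_frontier hG hx)
  set near : P.splineSpace r n := ∑ ξ ∈ b.indicesAt v, c ξ • b.basis ξ with near_def
  have near_frontier (x) (hx : x ∈ frontier P.domain) : near.1 x = 0 := by
    simp [near_def, Finset.sum_apply, b.eq_zero_on_frontier _ x hx]
  refine ⟨near, ⟨near.2, near_frontier⟩, ?_, fun x => b.sum_indicesAt_eq_zero_of_notMem c hT hv, ?_⟩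
  · rw [near_def, sum_indicesAt_apply, ← hc (hull_subset_domain hT hv)]
    simp
  · have decay := b.isRieszFamily.norm_sum_sq_le_pow_mul_norm_sum_sq b.lower_pos
      (mul_nonneg hκ b.lower_pos.le) (b.antitone_farIndices (p := p))
      (fun _ _ hξ _ => b.inner_eq_zero_of_notMem_farIndices hξ)
      (fun _ _ => b.inner_sum_eq_zero_of_mem_farIndices hS hGl hc)
      (b.indicesAt_subset_farIndices hT hv hm)
    simp only [← map_smul, ← map_sum] at decay
    rw [← splineGradient_congr hc, mul_div_cancel_right₀ _ b.lower_pos.ne',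
      show κ * b.lower / (b.lower + κ * b.lower) = κ / (1 + κ) by
        rw [← one_add_mul, mul_div_mul_right _ _ b.lower_pos.ne']] at decay
    rw [← norm_splineGradient_sq, ← norm_splineGradient_sq]
    refine decay.trans ?_
    gcongr
    exact hS.norm_splineGradient_sub_le hG

lemma OscillationLE.abs_apply_le_of_mem_starSet {G : EuclideanSpace ℝ (Fin d) → ℝ} {δ : ℝ}
    (hδ : P.OscillationLE G δ) (hGp : G p = 1) (hv : v ∈ P.starSet {p} l) :
    |G v| ≤ 1 + l * δ := by
  obtain ⟨T, hT, hvT⟩ := mem_iUnion₂.1 hv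
  obtain ⟨q, hq, bound⟩ := hδ.exists_abs_sub_le hT hvT
  rw [Finset.mem_singleton.1 hq, hGp, abs_sub_comm] at bound
  have := abs_sub_abs_le_abs_sub (G v) 1
  rw [abs_one] at this
  linarith

lemma LocalRieszBasis.abs_sub_le_mul_pow (b : P.LocalRieszBasis r n l κ) (hd : 1 ≤ d) (hκ : 0 ≤ κ)
    {S G : P.splineSpace r n} (hS : P.IsBoundaryGBCSpline r n p S)
    (hG : P.HasHatBoundaryValues p G) (hGl : ∀ x ∈ P.domain, x ∉ P.starSet {p} l → G.1 x = 0)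
    (hGA : P.energy G ≤ A * P.meshSize ^ (d - 2)) {C : ℝ}
    (hosc : ∀ u, P.IsSpline r n u → ∀ a, P.energy u ≤ a * P.meshSize ^ (d - 2) →
      P.OscillationLE u √(C * a)) {σ : ℝ} (hσ : 0 ≤ σ)
    (hσκ : σ ^ ((2 * l + 1) * 2) = κ / (1 + κ)) (hT : T ∈ P.simplices) (hv : v ∈ hull T)
    (hm : T ∈ P.star {p} ((2 * l + 1) * m + (l + 1)) → m = 0) :
    |S.1 v - G.1 v| ≤ (2 * l + 2) * √(C * (κ * A)) * σ ^ ((2 * l + 1) * m) := by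
  obtain ⟨u, hu, hSu, hu_support, hu_energy⟩ := b.exists_near_part hκ hS hG hGl hT hv hm
  have energy_le : P.energy u ≤
      κ * A * (σ ^ ((2 * l + 1) * m)) ^ 2 * P.meshSize ^ (d - 2) := by
    calc P.energy u ≤ κ * (κ / (1 + κ)) ^ m * P.energy G := hu_energy
      _ ≤ κ * (κ / (1 + κ)) ^ m * (A * P.meshSize ^ (d - 2)) := by gcongr
      _ = _ := by rw [← hσκ]; ring
  have bound := hu.abs_le_of_support hd (hosc u hu.1 _ energy_le) hT (by lia) hu_support hv
  rw [← mul_assoc, Real.sqrt_mul' _ (sq_nonneg _), Real.sqrt_sq (by positivity)] at bound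
  rw [hSu, add_sub_cancel_left]
  refine bound.trans_eq ?_
  push_cast
  ring

lemma OscillationLE.abs_apply_mul_pow_le {G : EuclideanSpace ℝ (Fin d) → ℝ} {δ σ : ℝ} {N : ℕ}
    (hδ : P.OscillationLE G δ) (hδ_nonneg : 0 ≤ δ) (hGp : G p = 1)
    (hGl : ∀ x ∈ P.domain, x ∉ P.starSet {p} l → G x = 0) (hT : T ∈ P.simplices)
    (hv : v ∈ hull T) (hTp : T ∉ P.star {p} (k + 1)) (hσ : 0 < σ) (hσ_lt : σ < 1) (hN : l ≤ N) :
    |G v| * σ ^ N ≤ (1 + l * δ) * σ ^ k := by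
  by_cases hvp : v ∈ P.starSet {p} l
  · have hkl : k < l := by
      by_contra! hlk
      exact hTp (star_mono (by lia) (mem_star_of_mem_starSet hT hv hvp))
    gcongr ?_ * ?_
    · exact hδ.abs_apply_le_of_mem_starSet hGp hvp
    · exact pow_le_pow_of_le_one hσ.le hσ_lt.le (by lia)
  · rw [hGl v (hull_subset_domain hT hv) hvp, abs_zero, zero_mul]
    positivity

lemma LocalRieszBasis.abs_mul_pow_le (b : P.LocalRieszBasis r n l κ) (hd : 1 ≤ d) (hκ : 0 ≤ κ)
    {S G : P.splineSpace r n} (hS : P.IsBoundaryGBCSpline r n p S)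
    (hG : P.HasHatBoundaryValues p G) (hGl : ∀ x ∈ P.domain, x ∉ P.starSet {p} l → G.1 x = 0)
    (hGA : P.energy G ≤ A * P.meshSize ^ (d - 2)) {C : ℝ}
    (hosc : ∀ u, P.IsSpline r n u → ∀ a, P.energy u ≤ a * P.meshSize ^ (d - 2) →
      P.OscillationLE u √(C * a)) {σ : ℝ} (hσ : 0 < σ) (hσ_lt : σ < 1)
    (hσκ : σ ^ ((2 * l + 1) * 2) = κ / (1 + κ)) (hp : p ∈ P.complex.vertices)
    (hpf : p ∈ frontier P.domain) (hT : T ∈ P.simplices) (hv : v ∈ hull T)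
    (hTp : T ∉ P.star {p} (k + 1)) :
    |S.1 v| * σ ^ (3 * l) ≤
      (1 + l * √(C * A) + (2 * l + 2) * √(C * (κ * A))) * σ ^ k := by
  set m := (k - l) / (2 * l + 1) with m_def
  have layers_le : (2 * l + 1) * m ≤ k - l := Nat.mul_div_le _ _
  have le_layers : k ≤ (2 * l + 1) * m + 3 * l := by
    have := Nat.lt_mul_div_succ (k - l) (Nat.succ_pos (2 * l))
    rw [Nat.succ_eq_add_one, mul_add, ← m_def] at this
    lia
  have difference_bound := b.abs_sub_le_mul_pow hd hκ hS hG hGl hGA hosc hσ.le hσκ hT hv (m := m)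
    fun hTm => by
      by_contra hm
      have : 0 < (2 * l + 1) * m := by positivity
      exact hTp (star_mono (by lia) hTm)
  have lift_bound := (hosc G.1 G.2 A hGA).abs_apply_mul_pow_le (Real.sqrt_nonneg _)
    (hG.apply_self hp hpf) hGl hT hv hTp hσ hσ_lt (show l ≤ 3 * l by lia)
  have triangle : |S.1 v| ≤ |G.1 v| + |S.1 v - G.1 v| := by
    linarith [abs_sub_abs_le_abs_sub (S.1 v) (G.1 v)]
  calc |S.1 v| * σ ^ (3 * l)
      ≤ |G.1 v| * σ ^ (3 * l) + |S.1 v - G.1 v| * σ ^ (3 * l) := by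
        rw [← add_mul]
        gcongr
    _ ≤ (1 + l * √(C * A)) * σ ^ k +
          (2 * l + 2) * √(C * (κ * A)) * σ ^ ((2 * l + 1) * m) * σ ^ (3 * l) := by gcongr
    _ = (1 + l * √(C * A)) * σ ^ k +
          (2 * l + 2) * √(C * (κ * A)) * σ ^ ((2 * l + 1) * m + 3 * l) := by ring
    _ ≤ (1 + l * √(C * A)) * σ ^ k + (2 * l + 2) * √(C * (κ * A)) * σ ^ k := by
        gcongr _ + _ * ?_
        exact pow_le_pow_of_le_one hσ.le hσ_lt.le le_layers
    _ = _ := by ring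

theorem exists_abs_le_mul_pow_of_hasLocalLift (κ : ℝ) (l : ℕ) : ∃ σ : ℝ, 0 < σ ∧ σ < 1 ∧
    ∀ (d n : ℕ) (β A : ℝ), 2 ≤ d → ∃ K : ℝ, 0 < K ∧
      ∀ (r : ℕ) (P : SimplicialPartition d), P.QuasiUniform β → P.HasLocalRieszBasis r n l κ →
        ∀ p ∈ P.complex.vertices, p ∈ frontier P.domain → P.HasLocalLift r n l A p →
          ∀ S : EuclideanSpace ℝ (Fin d) → ℝ, P.IsBoundaryGBCSpline r n p S →
            ∀ T ∈ P.simplices, ∀ v ∈ hull T, ∀ k : ℕ, 1 ≤ k →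
              Disjoint (P.starSet T k) (P.starSet {p} 1) → |S v| ≤ K * σ ^ k := by
  set κ' := max κ 1
  have κ'_pos : 0 < κ' := zero_lt_one.trans_le (le_max_right _ _)
  obtain ⟨σ, hσ, hσ_lt, hσκ⟩ := exists_pow_eq_of_lt_one (div_pos κ'_pos (add_pos one_pos κ'_pos))
    ((div_lt_one (by positivity)).2 (lt_one_add κ')) (N := (2 * l + 1) * 2) (by lia)
  refine ⟨σ, hσ, hσ_lt, fun d n β A hd => ?_⟩
  obtain ⟨C, -, hosc⟩ := QuasiUniform.exists_oscillationLE_sqrt d n β hd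
  refine ⟨(1 + l * √(C * A) + (2 * l + 2) * √(C * (κ' * A))) / σ ^ (3 * l), by positivity, ?_⟩
  rintro r P hP hbasis p hp hpf ⟨G, hG, hG_hat, hGl, hGA⟩ S hS T hT v hv k hk hdisj
  obtain ⟨b⟩ := hbasis.nonempty_localRieszBasis (le_max_left κ 1)
  rw [div_mul_eq_mul_div, le_div_iff₀ (by positivity)]
  exact b.abs_mul_pow_le (S := ⟨S, hS.1⟩) (G := ⟨G, hG⟩) (by lia) κ'_pos.le hS hG_hat hGl hGA
    (hosc P hP r) hσ hσ_lt hσκ hp hpf hT hv (notMem_star_of_disjoint hk hdisj)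

end SimplicialPartition

/-! ### Affine functions -/

section Affine

lemma norm_gradient_le_inv_of_mapsTo_Icc {E : Type*} [NormedAddCommGroup E]
    [InnerProductSpace ℝ E] [CompleteSpace E] (f : E →ᴬ[ℝ] ℝ) {c : E} {ρ : ℝ} (hρ : 0 < ρ)
    (hf : MapsTo f (Metric.closedBall c ρ) (Icc 0 1)) (x : E) : ‖gradient f x‖ ≤ ρ⁻¹ := by
  rw [gradient, LinearIsometryEquiv.norm_map, f.hasFDerivAt.fderiv]
  refine ContinuousLinearMap.opNorm_le_of_unit_norm (inv_nonneg.2 hρ.le) fun y hy => ?_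
  have map_sub : ρ * f.contLinear y = f (c + ρ • y) - f c := by
    rw [← vsub_eq_sub, ← f.contLinear_map_vsub, vsub_eq_sub, add_sub_cancel_left, map_smul,
      smul_eq_mul]
  have abs_le_one : |f (c + ρ • y) - f c| ≤ 1 := by
    refine (abs_sub_le_of_le_of_le (hf ?_).1 (hf ?_).2 (hf ?_).1 (hf ?_).2).trans_eq (sub_zero 1)
    all_goals simp [norm_smul, hy, abs_of_pos hρ, hρ.le]
  rw [← map_sub, abs_mul, abs_of_pos hρ] at abs_le_one
  rwa [Real.norm_eq_abs, ← one_div, le_div_iff₀' hρ]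

lemma exists_polyFun_eq_affineMap {ι : Type*} [Fintype ι] (f : EuclideanSpace ℝ ι →ᵃ[ℝ] ℝ) :
    ∃ p : MvPolynomial ι ℝ, p.totalDegree ≤ 1 ∧ polyFun p = f := by
  let g := (InnerProductSpace.toDual ℝ (EuclideanSpace ℝ ι)).symm
    (LinearMap.toContinuousLinearMap f.linear)
  refine ⟨∑ i, MvPolynomial.C (g i) * MvPolynomial.X i + MvPolynomial.C (f 0), ?_,
    funext fun x => ?_⟩
  · refine (MvPolynomial.totalDegree_add _ _).trans (max_le ?_ (by simp))
    refine MvPolynomial.totalDegree_finsetSum_le fun i _ => ?_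
    refine (MvPolynomial.totalDegree_mul _ _).trans ?_
    simp
  · have linear_eq : f.linear x = ∑ i, x i * g i := by
      rw [← LinearMap.coe_toContinuousLinearMap' f.linear, ← InnerProductSpace.toDual_symm_apply,
        PiLp.inner_apply]
      rfl
    rw [congrFun f.decomp x, Pi.add_apply, linear_eq]
    simp [polyFun_apply, mul_comm]

lemma affineMap_apply_sum_smul {k V W : Type*} [Ring k] [AddCommGroup V] [Module k V]
    [AddCommGroup W] [Module k W] (f : V →ᵃ[k] W) (s : Finset V) {w : V → k}
    (hw : ∑ q ∈ s, w q = 1) : f (∑ q ∈ s, w q • q) = ∑ q ∈ s, w q • f q := by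
  have h := s.map_affineCombination id w hw f
  rwa [s.affineCombination_eq_linear_combination _ _ hw,
    s.affineCombination_eq_linear_combination _ _ hw] at h

end Affine

namespace SimplicialPartition

variable {d : ℕ} {P : SimplicialPartition d} {s T T' : Finset (EuclideanSpace ℝ (Fin d))}
  {p q v x : EuclideanSpace ℝ (Fin d)} {w : EuclideanSpace ℝ (Fin d) → ℝ} {n l : ℕ} {β : ℝ}

/-! ### Barycentric coordinates -/

/-- The vertices of a simplex of the partition as an affine basis of the ambient space. -/
def simplexBasis (hT : T ∈ P.simplices) : AffineBasis T ℝ (EuclideanSpace ℝ (Fin d)) where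
  toFun := (↑)
  ind' := P.complex.indep hT.1
  tot' := by
    rw [(P.complex.indep hT.1).affineSpan_eq_top_iff_card_eq_finrank_add_one]
    simp [hT.2]

open Classical in
variable (P) in
/-- The barycentric coordinate of the simplex `T` that belongs to the vertex `v`, extended affinely
to the ambient space; it is set to zero if `v` is no vertex of `T`. -/
def bary (T : Finset (EuclideanSpace ℝ (Fin d))) (v : EuclideanSpace ℝ (Fin d)) :
    EuclideanSpace ℝ (Fin d) →ᵃ[ℝ] ℝ :=
  if h : T ∈ P.simplices ∧ v ∈ T then (simplexBasis h.1).coord ⟨v, h.2⟩ else 0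

lemma bary_of_mem (hT : T ∈ P.simplices) (hv : v ∈ T) :
    P.bary T v = (simplexBasis hT).coord ⟨v, hv⟩ := dif_pos ⟨hT, hv⟩

lemma bary_of_notMem (hv : v ∉ T) : P.bary T v = 0 := dif_neg fun h => hv h.2

lemma sum_bary (hT : T ∈ P.simplices) (x : EuclideanSpace ℝ (Fin d)) :
    ∑ v ∈ T, P.bary T v x = 1 := by
  rw [← Finset.sum_coe_sort, ← (simplexBasis hT).sum_coord_apply_eq_one x]
  exact Finset.sum_congr rfl fun v _ => by rw [bary_of_mem hT v.2]

lemma sum_bary_smul (hT : T ∈ P.simplices) (x : EuclideanSpace ℝ (Fin d)) :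
    ∑ v ∈ T, P.bary T v x • v = x := by
  rw [← Finset.sum_coe_sort T fun v => P.bary T v x • v]
  conv_rhs => rw [← (simplexBasis hT).linear_combination_coord_eq_self x]
  exact Finset.sum_congr rfl fun v _ => by rw [bary_of_mem hT v.2]; rfl

open Classical in
lemma bary_apply_vertex (hT : T ∈ P.simplices) (hq : q ∈ T) :
    P.bary T v q = if v = q then 1 else 0 := by
  by_cases hv : v ∈ T
  · have h : P.bary T v q = _ :=
      bary_of_mem hT hv ▸ (simplexBasis hT).coord_apply ⟨v, hv⟩ ⟨q, hq⟩
    simpa only [Subtype.mk.injEq] using h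
  · rw [bary_of_notMem hv, if_neg (by rintro rfl; exact hv hq)]
    rfl

open Classical in
lemma bary_apply_sum_smul (hT : T ∈ P.simplices) (hs : s ⊆ T) (hw : ∑ q ∈ s, w q = 1)
    (v : EuclideanSpace ℝ (Fin d)) :
    P.bary T v (∑ q ∈ s, w q • q) = if v ∈ s then w v else 0 := by
  rw [affineMap_apply_sum_smul _ _ hw,
    Finset.sum_congr rfl fun q hq => by rw [bary_apply_vertex hT (hs hq)]]
  simp

lemma mem_hull_iff (hT : T ∈ P.simplices) : x ∈ hull T ↔ ∀ v, 0 ≤ P.bary T v x := by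
  constructor
  · intro hx v
    obtain ⟨w, hw₀, hw₁, rfl⟩ := Finset.mem_convexHull'.1 hx
    rw [bary_apply_sum_smul hT subset_rfl hw₁]
    split_ifs with hv
    exacts [hw₀ v hv, le_rfl]
  · exact fun h => Finset.mem_convexHull'.2
      ⟨fun v => P.bary T v x, fun v _ => h v, sum_bary hT x, sum_bary_smul hT x⟩

lemma bary_mem_Icc (hT : T ∈ P.simplices) (hx : x ∈ hull T) (v : EuclideanSpace ℝ (Fin d)) :
    P.bary T v x ∈ Icc 0 1 := by
  refine ⟨(mem_hull_iff hT).1 hx v, ?_⟩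
  by_cases hv : v ∈ T
  · rw [← sum_bary hT x]
    exact Finset.single_le_sum (f := fun v => P.bary T v x)
      (fun q _ => (mem_hull_iff hT).1 hx q) hv
  · rw [bary_of_notMem hv]
    exact zero_le_one

lemma bary_eq_bary (hT : T ∈ P.simplices) (hT' : T' ∈ P.simplices) (hx : x ∈ hull T)
    (hx' : x ∈ hull T') (v : EuclideanSpace ℝ (Fin d)) : P.bary T v x = P.bary T' v x := by
  classical
  have h := P.complex.inter_subset_convexHull hT.1 hT'.1 ⟨hx, hx'⟩
  rw [← Finset.coe_inter] at h
  obtain ⟨w, -, hw, rfl⟩ := Finset.mem_convexHull'.1 h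
  rw [bary_apply_sum_smul hT Finset.inter_subset_left hw,
    bary_apply_sum_smul hT' Finset.inter_subset_right hw]

/-! ### Hat functions -/

open Classical in
variable (P) in
/-- The hat function of `v`: continuous and piecewise linear, `1` at `v` and `0` at the other
vertices of the partition. Outside the domain it is set to zero. -/
def hat (v x : EuclideanSpace ℝ (Fin d)) : ℝ :=
  if h : ∃ T ∈ P.simplices, x ∈ hull T then P.bary h.choose v x else 0

lemma hat_eq_bary (hT : T ∈ P.simplices) (hx : x ∈ hull T) (v : EuclideanSpace ℝ (Fin d)) :
    P.hat v x = P.bary T v x := by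
  have h : ∃ T ∈ P.simplices, x ∈ hull T := ⟨T, hT, hx⟩
  rw [hat, dif_pos h]
  exact bary_eq_bary h.choose_spec.1 hT h.choose_spec.2 hx v

lemma isSpline_zero_of_forall_exists_polyFun {u : EuclideanSpace ℝ (Fin d) → ℝ}
    (h : ∀ T ∈ P.simplices, ∃ p : MvPolynomial (Fin d) ℝ,
      p.totalDegree ≤ n ∧ EqOn u (polyFun p) (hull T)) : P.IsSpline 0 n u := by
  have hu : ContinuousOn u P.domain := by
    have := simplices_finite (P := P).to_subtype
    rw [domain_eq_biUnion, biUnion_eq_iUnion]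
    refine LocallyFinite.continuousOn_iUnion (locallyFinite_of_finite _)
      (fun T => (isCompact_hull _).isClosed) fun T => ?_
    obtain ⟨p, -, hp⟩ := h T T.2
    exact (contDiff_polyFun p).continuous.continuousOn.congr hp
  exact ⟨hu, by rw [Nat.cast_zero]; exact contDiffOn_zero.2 (hu.mono interior_subset), h⟩

lemma isSpline_hat (hn : 1 ≤ n) (v : EuclideanSpace ℝ (Fin d)) : P.IsSpline 0 n (P.hat v) := by
  refine isSpline_zero_of_forall_exists_polyFun fun T hT => ?_
  obtain ⟨p, hp, hp_eq⟩ := exists_polyFun_eq_affineMap (P.bary T v)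
  exact ⟨p, hp.trans hn, fun x hx => by rw [hat_eq_bary hT hx, hp_eq]⟩

open Classical in
lemma hat_apply_sum_smul (hs : s ∈ P.complex.faces) (hw₀ : ∀ q ∈ s, 0 ≤ w q)
    (hw : ∑ q ∈ s, w q = 1) (v : EuclideanSpace ℝ (Fin d)) :
    P.hat v (∑ q ∈ s, w q • q) = if v ∈ s then w v else 0 := by
  obtain ⟨T, hT, hsT, hcard⟩ := P.pure s hs
  rw [hat_eq_bary (T := T) ⟨hT, hcard⟩, bary_apply_sum_smul ⟨hT, hcard⟩ hsT hw]
  exact convexHull_mono (Finset.coe_subset.2 hsT) (Finset.mem_convexHull'.2 ⟨w, hw₀, hw, rfl⟩)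

lemma hasHatBoundaryValues_hat (p : EuclideanSpace ℝ (Fin d)) :
    P.HasHatBoundaryValues p (P.hat p) := by
  classical
  intro s hs w hw₀ hw _
  rw [hat_apply_sum_smul hs hw₀ hw]
  exact ⟨fun h => if_pos h, fun h => if_neg h⟩

lemma hat_eq_zero (hx : x ∈ P.domain) (h : x ∉ P.starSet {v} 1) : P.hat v x = 0 := by
  obtain ⟨T, hT, hxT⟩ := mem_domain_iff.1 hx
  rw [hat_eq_bary hT hxT, bary_of_notMem]
  · rfl
  · exact fun hv => h (mem_biUnion ⟨hT, v, hv, Finset.mem_singleton_self v⟩ hxT)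

lemma meshSize_nonneg : 0 ≤ P.meshSize :=
  Real.sSup_nonneg (by rintro _ ⟨T, -, rfl⟩; exact Metric.diam_nonneg)

lemma QuasiUniform.norm_gradient_hat_le (hP : P.QuasiUniform β) (hd : 1 ≤ d)
    (hT : T ∈ P.simplices) (hx : x ∈ interior (hull T)) (v : EuclideanSpace ℝ (Fin d)) :
    ‖gradient (P.hat v) x‖ ≤ 2 * β * P.meshSize⁻¹ := by
  obtain ⟨c, ρ, hρ, hball, hmesh⟩ := hP.exists_closedBall_subset hd hT
  have meshSize_pos := meshSize_pos hd hT
  have hat_eq : P.hat v =ᶠ[nhds x] P.bary T v :=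
    eventuallyEq_of_eqOn_hull (fun y hy => hat_eq_bary hT hy v) hx
  have gradient_le : ‖gradient (P.bary T v) x‖ ≤ ρ⁻¹ :=
    norm_gradient_le_inv_of_mapsTo_Icc
      ⟨P.bary T v, (P.bary T v).continuous_of_finiteDimensional⟩ hρ
      (fun y hy => bary_mem_Icc hT (hball hy) v) x
  calc ‖gradient (P.hat v) x‖ ≤ ρ⁻¹ := hat_eq.gradient_eq ▸ gradient_le
    _ ≤ 2 * β * P.meshSize⁻¹ := by
        rw [← div_eq_mul_inv, inv_le_iff_one_le_mul₀ hρ, div_mul_eq_mul_div,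
          one_le_div₀ meshSize_pos]
        exact hmesh

lemma QuasiUniform.ae_sq_norm_gradient_hat_le_indicator (hP : P.QuasiUniform β) (hd : 1 ≤ d)
    (v : EuclideanSpace ℝ (Fin d)) :
    ∀ᵐ x ∂volume.restrict P.domain, ‖gradient (P.hat v) x‖ ^ 2 ≤
      (Metric.closedBall v P.meshSize).indicator (fun _ => (2 * β * P.meshSize⁻¹) ^ 2) x := by
  filter_upwards [ae_exists_mem_interior_hull] with x ⟨T, hT, hx⟩
  by_cases hvT : v ∈ T
  · have hx_ball : x ∈ Metric.closedBall v P.meshSize :=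
      dist_le_meshSize hT (interior_subset hx) (subset_convexHull ℝ _ hvT)
    rw [indicator_of_mem hx_ball]
    exact pow_le_pow_left₀ (norm_nonneg _) (hP.norm_gradient_hat_le hd hT hx v) 2
  · have hat_zero : ∀ y ∈ hull T, P.hat v y = 0 := fun y hy => by
      rw [hat_eq_bary hT hy, bary_of_notMem hvT]
      rfl
    rw [gradient_eq_zero_of_eqOn_const hat_zero hx, norm_zero, zero_pow two_ne_zero]
    exact indicator_nonneg (fun _ _ => sq_nonneg _) x

theorem QuasiUniform.energy_hat_le (hP : P.QuasiUniform β) (hd : 2 ≤ d)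
    (v : EuclideanSpace ℝ (Fin d)) :
    P.energy (P.hat v) ≤ (2 * β) ^ 2 *
      volume.real (Metric.ball (0 : EuclideanSpace ℝ (Fin d)) 1) * P.meshSize ^ (d - 2) := by
  rcases P.simplices.eq_empty_or_nonempty with hP_empty | ⟨T, hT⟩
  · rw [energy, domain_eq_biUnion, hP_empty, biUnion_empty, setIntegral_empty]
    exact mul_nonneg (by positivity) (pow_nonneg meshSize_nonneg _)
  have meshSize_pos := meshSize_pos (by omega) hT
  set F := (Metric.closedBall v P.meshSize).indicator fun _ => (2 * β * P.meshSize⁻¹) ^ 2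
  have hF : Integrable F :=
    (integrable_indicator_iff Metric.isClosed_closedBall.measurableSet).2
      (integrableOn_const (isCompact_closedBall _ _).measure_lt_top.ne)
  calc P.energy (P.hat v) ≤ ∫ x in P.domain, F x :=
        integral_mono_of_nonneg (.of_forall fun _ => sq_nonneg _) hF.restrict
          (hP.ae_sq_norm_gradient_hat_le_indicator (by omega) v)
    _ ≤ ∫ x, F x := setIntegral_le_integral hF
        (.of_forall fun x => indicator_nonneg (fun _ _ => sq_nonneg _) x)
    _ = P.meshSize ^ d * volume.real (Metric.ball (0 : EuclideanSpace ℝ (Fin d)) 1) *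
          (2 * β * P.meshSize⁻¹) ^ 2 := by
        rw [integral_indicator Metric.isClosed_closedBall.measurableSet, setIntegral_const,
          smul_eq_mul, Measure.addHaar_real_closedBall _ _ meshSize_pos.le,
          finrank_euclideanSpace_fin]
    _ = _ := by
        rw [← pow_sub_mul_pow P.meshSize hd]
        field_simp

theorem QuasiUniform.hasLocalLift_zero (hP : P.QuasiUniform β) (hd : 2 ≤ d) (hn : 1 ≤ n)
    (hl : 1 ≤ l) (p : EuclideanSpace ℝ (Fin d)) :
    P.HasLocalLift 0 n l ((2 * β) ^ 2 *
      volume.real (Metric.ball (0 : EuclideanSpace ℝ (Fin d)) 1)) p :=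
  ⟨P.hat p, isSpline_hat hn p, hasHatBoundaryValues_hat p,
    fun _ hx hxs => hat_eq_zero hx fun h => hxs (biUnion_subset_biUnion_left (star_mono hl) h),
    hP.energy_hat_le hd p⟩

lemma HasLocalLift.mono {r : ℕ} {A A' : ℝ} (hA : P.HasLocalLift r n l A p) (h : A ≤ A') :
    P.HasLocalLift r n l A' p := by
  obtain ⟨G, hG, hGp, hG_support, hG_energy⟩ := hA
  exact ⟨G, hG, hGp, hG_support,
    hG_energy.trans (mul_le_mul_of_nonneg_right h (pow_nonneg meshSize_nonneg _))⟩

end SimplicialPartition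

namespace SimplicialPartition

variable {d : ℕ} {P : SimplicialPartition d} {T T' : Finset (EuclideanSpace ℝ (Fin d))}
  {x y : EuclideanSpace ℝ (Fin d)} {u : EuclideanSpace ℝ (Fin d) → ℝ} {r n : ℕ}

/-! ### Definiteness of the energy -/

lemma interior_hull_nonempty (hT : T ∈ P.simplices) : (interior (hull T)).Nonempty := by
  rw [interior_convexHull_nonempty_iff_affineSpan_eq_top]
  have range_eq : range (simplexBasis hT) = T := Subtype.range_coe
  exact range_eq ▸ (simplexBasis hT).tot

lemma hull_subset_closure_interior (hT : T ∈ P.simplices) :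
    hull T ⊆ closure (interior (hull T)) := by
  rw [(convex_convexHull ℝ _).closure_interior_eq_closure_of_nonempty_interior
    (interior_hull_nonempty hT)]
  exact subset_closure

lemma IsSpline.eq_of_energy_eq_zero (hu : P.IsSpline r n u) (hE : P.energy u = 0)
    (hT : T ∈ P.simplices) (hx : x ∈ hull T) (hy : y ∈ hull T) : u x = u y := by
  obtain ⟨p, -, hup⟩ := hu.exists_polyFun hT
  obtain ⟨z, hz⟩ := interior_hull_nonempty hT
  have integral_eq_zero : ∫ x in interior (hull T), ‖gradient (polyFun p) x‖ ^ 2 = 0 :=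
    le_antisymm ((hu.setIntegral_polyFun_le_energy hT hup isOpen_interior interior_subset).trans
      hE.le) (integral_nonneg fun _ => sq_nonneg _)
  have const_on_hull : hull T ⊆ {x | polyFun p x = polyFun p z} :=
    (hull_subset_closure_interior hT).trans <| closure_minimal
      (fun y hy => eq_of_setIntegral_gradient_eq_zero (contDiff_polyFun p) isOpen_interior
        (convex_convexHull ℝ _).interior ((isCompact_hull T).isBounded.subset interior_subset)
        integral_eq_zero hy hz)
      (isClosed_eq (contDiff_polyFun p).continuous continuous_const)
  rw [hup hx, hup hy, const_on_hull hx, const_on_hull hy]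

theorem IsSplineZero.eq_zero_of_energy_eq_zero (hd : 1 ≤ d) (hu : P.IsSplineZero r n u)
    (hE : P.energy u = 0) (hx : x ∈ P.domain) : u x = 0 := by
  have : Nonempty (Fin d) := ⟨⟨0, hd⟩⟩
  have hK : IsCompact (P.domain ∩ u ⁻¹' {u x}) :=
    isCompact_domain.of_isClosed_subset
      (hu.1.1.preimage_isClosed_of_isClosed isCompact_domain.isClosed isClosed_singleton)
      inter_subset_left
  obtain ⟨y, ⟨-, hyx⟩, hy⟩ := exists_eq_zero_of_forall_mem_nhds hK ⟨x, hx, rfl⟩ inter_subset_left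
    hu.2 fun y hy hy_int _ => by
      filter_upwards [P.eventually_exists_hull y, mem_interior_iff_mem_nhds.1 hy_int]
        with z hz hz_domain
      obtain ⟨T, hT, hyT, hzT⟩ := hz hz_domain
      exact ⟨hz_domain, (hu.1.eq_of_energy_eq_zero hE hT hzT hyT).trans hy.2⟩
  exact (mem_singleton_iff.1 hyx).symm.trans hy

/-! ### The boundary is a union of faces -/

lemma mem_hull_of_bary_eq_zero_imp (hT : T ∈ P.simplices) (hT' : T' ∈ P.simplices)
    (hx : x ∈ hull T) (hy : y ∈ hull T) (hyT' : y ∈ hull T')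
    (h : ∀ v, P.bary T v y = 0 → P.bary T v x = 0) : x ∈ hull T' := by
  have carrier_subset : ({v ∈ T | P.bary T v x ≠ 0} : Finset _) ⊆ T' := by
    intro v hv
    by_contra hvT'
    refine (Finset.mem_filter.1 hv).2 (h v ?_)
    rw [bary_eq_bary hT hT' hy hyT', bary_of_notMem hvT']
    rfl
  refine convexHull_mono (Finset.coe_subset.2 carrier_subset) (Finset.mem_convexHull'.2
    ⟨fun v => P.bary T v x, fun v _ => (mem_hull_iff hT).1 hx v, ?_, ?_⟩)
  · rw [Finset.sum_filter_ne_zero, sum_bary hT]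
  · rw [Finset.sum_filter_of_ne, sum_bary_smul hT]
    exact fun v _ hv hv₀ => hv (by simp only [hv₀, zero_smul])

lemma eventually_mem_hull_of_add_sub_mem_hull (hT : T ∈ P.simplices) (hx : x ∈ hull T)
    (h : ∀ v, P.bary T v x = 0 → P.bary T v y = 0) :
    ∀ᶠ z in nhds x, y + (z - x) ∈ hull T → z ∈ hull T := by
  have bary_pos : ∀ᶠ z in nhds x, ∀ v ∈ T, 0 < P.bary T v x → 0 < P.bary T v z := by
    rw [Filter.eventually_all_finset]
    intro v _
    by_cases hv : 0 < P.bary T v x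
    · filter_upwards [(P.bary T v).continuous_of_finiteDimensional.continuousAt.eventually
        (lt_mem_nhds hv)] with z hz _ using hz
    · exact .of_forall fun _ hv' => absurd hv' hv
  filter_upwards [bary_pos] with z hz hz_hull
  refine (mem_hull_iff hT).2 fun v => ?_
  by_cases hvT : v ∈ T
  · rcases ((mem_hull_iff hT).1 hx v).lt_or_eq with hv | hv
    · exact (hz v hvT hv).le
    · have bary_add_sub : P.bary T v (y + (z - x)) = P.bary T v z := by
        rw [add_comm, ← vadd_eq_add, AffineMap.map_vadd, ← vsub_eq_sub, AffineMap.linearMap_vsub,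
          h v hv.symm, ← hv, vsub_eq_sub, vadd_eq_add, sub_zero, add_zero]
      exact bary_add_sub ▸ (mem_hull_iff hT).1 hz_hull v
  · rw [bary_of_notMem hvT]
    exact le_rfl

/- Near a point the domain looks the same, up to translation, as near any other point with the same
carrier face. -/
lemma mem_interior_domain_of_bary_eq_zero_iff (hT : T ∈ P.simplices) (hx : x ∈ hull T)
    (hy : y ∈ hull T) (hxy : ∀ v, P.bary T v x = 0 ↔ P.bary T v y = 0)
    (hy_int : y ∈ interior P.domain) : x ∈ interior P.domain := by
  have translate_back : ∀ᶠ z in nhds x, ∀ T' ∈ P.simplices, y ∈ hull T' →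
      y + (z - x) ∈ hull T' → z ∈ hull T' := by
    rw [Filter.eventually_all_finite simplices_finite]
    intro T' hT'
    by_cases hyT' : y ∈ hull T'
    · have hxT' := mem_hull_of_bary_eq_zero_imp hT hT' hx hy hyT' fun v => (hxy v).2
      have h := eventually_mem_hull_of_add_sub_mem_hull (y := y) hT' hxT' fun v => by
        rw [← bary_eq_bary hT hT' hx hxT', ← bary_eq_bary hT hT' hy hyT']
        exact (hxy v).1
      filter_upwards [h] with z hz _ using hz
    · exact .of_forall fun _ hy' => absurd hy' hyT'
  have tendsto_y : Filter.Tendsto (fun z => y + (z - x)) (nhds x) (nhds y) := by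
    have h : Continuous fun z => y + (z - x) := by fun_prop
    simpa only [sub_self, add_zero] using h.tendsto x
  rw [mem_interior_iff_mem_nhds]
  filter_upwards [translate_back, tendsto_y.eventually (P.eventually_exists_hull y),
    tendsto_y.eventually (mem_interior_iff_mem_nhds.1 hy_int)] with z hz hz_hull hz_domain
  obtain ⟨T', hT', hyT', hzT'⟩ := hz_hull hz_domain
  exact mem_domain_iff.2 ⟨T', hT', hz T' hT' hyT' hzT'⟩

theorem mem_frontier_domain_of_bary_eq_zero_imp (hT : T ∈ P.simplices) (hx : x ∈ hull T)
    (hy : y ∈ hull T) (hxy : ∀ v, P.bary T v x = 0 → P.bary T v y = 0)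
    (hx_frontier : x ∈ frontier P.domain) : y ∈ frontier P.domain := by
  refine ⟨subset_closure (hull_subset_domain hT hy), fun hy_int => hx_frontier.2 ?_⟩
  have tendsto_y : Filter.Tendsto (AffineMap.lineMap y x : ℝ →ᵃ[ℝ] _) (nhdsWithin 0 (Ioo 0 1))
      (nhds y) := by
    simpa only [AffineMap.lineMap_apply_zero] using
      (AffineMap.lineMap_continuous.tendsto (0 : ℝ)).mono_left nhdsWithin_le_nhds
  have : (nhdsWithin (0 : ℝ) (Ioo 0 1)).NeBot := left_nhdsWithin_Ioo_neBot zero_lt_one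
  -- A point of the segment from `y` to `x`, close to `y`, has the carrier of `x`.
  obtain ⟨t, ht_int, ht₀, ht₁⟩ := ((tendsto_y.eventually (isOpen_interior.mem_nhds hy_int)).and
    self_mem_nhdsWithin).exists
  refine mem_interior_domain_of_bary_eq_zero_iff hT hx
    ((convex_convexHull ℝ _).lineMap_mem hy hx ⟨ht₀.le, ht₁.le⟩) (fun v => ?_) ht_int
  have bary_line : P.bary T v (AffineMap.lineMap y x t) =
      (1 - t) * P.bary T v y + t * P.bary T v x := by
    rw [AffineMap.apply_lineMap, AffineMap.lineMap_apply_module, smul_eq_mul, smul_eq_mul]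
  have hx_nonneg := (mem_hull_iff hT).1 hx v
  have hy_nonneg := (mem_hull_iff hT).1 hy v
  rw [bary_line]
  refine ⟨fun hv => by rw [hv, hxy v hv, mul_zero, mul_zero, add_zero], fun hv => ?_⟩
  have h := (add_eq_zero_iff_of_nonneg (mul_nonneg (sub_nonneg.2 ht₁.le) hy_nonneg)
    (mul_nonneg ht₀.le hx_nonneg)).1 hv
  exact (mul_eq_zero.1 h.2).resolve_left ht₀.ne'

end SimplicialPartition

/-! ### Restriction of continuous splines to faces -/

section Homogenization

variable {ι κ K : Type*} [Field K]

lemma prod_pow_mul_pow_sub_eq {t : Finset ι} {e : ι → ℕ} {n : ℕ} {a : K} {m : ι → K}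
    (hn : n ≠ 0) (he : ∑ i ∈ t, e i ≤ n) (hm : a = 0 → ∀ i, m i = 0) :
    (∏ i ∈ t, m i ^ e i) * a ^ (n - ∑ i ∈ t, e i) = a ^ n * ∏ i ∈ t, (a⁻¹ * m i) ^ e i := by
  rcases eq_or_ne a 0 with rfl | ha
  · rw [zero_pow hn, zero_mul]
    rcases eq_or_ne (∑ i ∈ t, e i) 0 with hsum | hsum
    · rw [hsum, Nat.sub_zero, zero_pow hn, mul_zero]
    · obtain ⟨i, hi, hei⟩ := Finset.exists_ne_zero_of_sum_ne_zero hsum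
      rw [Finset.prod_eq_zero hi (by rw [hm rfl, zero_pow hei]), zero_mul]
  · simp only [mul_pow, Finset.prod_mul_distrib, Finset.prod_pow_eq_pow_sum]
    rw [← pow_sub_mul_pow a he, inv_pow]
    field_simp

lemma totalDegree_prod_pow_mul_pow_sub_le {γ : ι →₀ ℕ} {n : ℕ} (hγ : (γ.sum fun _ e => e) ≤ n)
    {s : MvPolynomial κ K} (hs : s.totalDegree ≤ 1) {m : ι → MvPolynomial κ K}
    (hm : ∀ i, (m i).totalDegree ≤ 1) :
    ((∏ i ∈ γ.support, m i ^ γ i) * s ^ (n - γ.sum fun _ e => e)).totalDegree ≤ n := by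
  have totalDegree_pow_le {q : MvPolynomial κ K} (hq : q.totalDegree ≤ 1) (j : ℕ) :
      (q ^ j).totalDegree ≤ j :=
    (MvPolynomial.totalDegree_pow _ _).trans (mul_le_of_le_one_right' hq)
  calc _ ≤ (∏ i ∈ γ.support, m i ^ γ i).totalDegree +
        (s ^ (n - γ.sum fun _ e => e)).totalDegree := MvPolynomial.totalDegree_mul _ _
    _ ≤ (γ.sum fun _ e => e) + (n - γ.sum fun _ e => e) :=
      add_le_add ((MvPolynomial.totalDegree_finsetProd _ _).trans
        (Finset.sum_le_sum fun i _ => totalDegree_pow_le (hm i) _)) (totalDegree_pow_le hs _)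
    _ = n := Nat.add_sub_cancel' hγ

/- `q` comes from substituting affine functions into the degree `n` homogenization of `p`. -/
lemma exists_eval_eq_pow_mul_eval {n : ℕ} (hn : n ≠ 0) {p : MvPolynomial ι K}
    (hp : p.totalDegree ≤ n) {s : MvPolynomial κ K} (hs : s.totalDegree ≤ 1)
    {m : ι → MvPolynomial κ K} (hm : ∀ i, (m i).totalDegree ≤ 1) :
    ∃ q : MvPolynomial κ K, q.totalDegree ≤ n ∧
      ∀ x : κ → K, (MvPolynomial.eval x s = 0 → ∀ i, MvPolynomial.eval x (m i) = 0) →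
        MvPolynomial.eval x q = MvPolynomial.eval x s ^ n *
          MvPolynomial.eval (fun i => (MvPolynomial.eval x s)⁻¹ * MvPolynomial.eval x (m i)) p := by
  have degree_le {γ : ι →₀ ℕ} (hγ : γ ∈ p.support) : (γ.sum fun _ e => e) ≤ n :=
    (MvPolynomial.le_totalDegree hγ).trans hp
  refine ⟨∑ γ ∈ p.support, p.coeff γ •
    ((∏ i ∈ γ.support, m i ^ γ i) * s ^ (n - γ.sum fun _ e => e)), ?_, fun x hx => ?_⟩
  · exact MvPolynomial.totalDegree_finsetSum_le fun γ hγ =>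
      (MvPolynomial.totalDegree_smul_le _ _).trans
        (totalDegree_prod_pow_mul_pow_sub_le (degree_le hγ) hs hm)
  · simp only [map_sum, MvPolynomial.smul_eval, map_mul, map_prod, map_pow]
    rw [MvPolynomial.eval_eq (fun i => _) p, Finset.mul_sum]
    refine Finset.sum_congr rfl fun γ hγ => ?_
    rw [Finsupp.sum, prod_pow_mul_pow_sub_eq hn (degree_le hγ) hx, mul_left_comm]

end Homogenization

namespace SimplicialPartition

variable {d n : ℕ} {P : SimplicialPartition d} {A T : Finset (EuclideanSpace ℝ (Fin d))}
  {u : EuclideanSpace ℝ (Fin d) → ℝ} {v x : EuclideanSpace ℝ (Fin d)}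

variable (P) in
/-- The sum of the barycentric coordinates of `x` that belong to vertices in `A`. -/
def faceWeight (A : Finset (EuclideanSpace ℝ (Fin d))) (x : EuclideanSpace ℝ (Fin d)) : ℝ :=
  ∑ v ∈ A, P.hat v x

variable (P) in
/-- The projection of `x` onto the face of its simplex that is spanned by the vertices in `A`, by
dropping the other barycentric coordinates and rescaling. Its value is only meaningful if
`P.faceWeight A x ≠ 0`. -/
def faceProj (A : Finset (EuclideanSpace ℝ (Fin d))) (x : EuclideanSpace ℝ (Fin d)) :
    EuclideanSpace ℝ (Fin d) :=
  (P.faceWeight A x)⁻¹ • ∑ v ∈ A, P.hat v x • v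

variable (P) in
/-- The part of a spline `u` of degree `n` that involves only the vertices in `A`: in the Bernstein
form of `u` on a simplex, the Bernstein polynomials that contain a barycentric coordinate of a
vertex outside `A` are dropped. -/
def faceRestrict (n : ℕ) (A : Finset (EuclideanSpace ℝ (Fin d)))
    (u : EuclideanSpace ℝ (Fin d) → ℝ) (x : EuclideanSpace ℝ (Fin d)) : ℝ :=
  P.faceWeight A x ^ n * u (P.faceProj A x)

section

variable [DecidableEq (EuclideanSpace ℝ (Fin d))]

lemma sum_hat_smul {M : Type*} [AddCommGroup M] [Module ℝ M] (hT : T ∈ P.simplices)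
    (hx : x ∈ hull T) (A : Finset (EuclideanSpace ℝ (Fin d)))
    (f : EuclideanSpace ℝ (Fin d) → M) :
    ∑ v ∈ A, P.hat v x • f v = ∑ v ∈ A ∩ T, P.bary T v x • f v := by
  simp only [hat_eq_bary hT hx]
  refine (Finset.sum_subset Finset.inter_subset_left fun v hvA hv => ?_).symm
  rw [bary_of_notMem fun h => hv (Finset.mem_inter.2 ⟨hvA, h⟩)]
  exact zero_smul _ _

lemma faceWeight_eq_sum_bary (hT : T ∈ P.simplices) (hx : x ∈ hull T)
    (A : Finset (EuclideanSpace ℝ (Fin d))) :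
    P.faceWeight A x = ∑ v ∈ A ∩ T, P.bary T v x := by
  simpa only [faceWeight, smul_eq_mul, mul_one] using sum_hat_smul hT hx A fun _ => (1 : ℝ)

lemma sum_inv_faceWeight_mul_bary (hT : T ∈ P.simplices) (hx : x ∈ hull T)
    (hA : P.faceWeight A x ≠ 0) :
    ∑ v ∈ A ∩ T, (P.faceWeight A x)⁻¹ * P.bary T v x = 1 := by
  rw [← Finset.mul_sum, ← faceWeight_eq_sum_bary hT hx, inv_mul_cancel₀ hA]

lemma faceProj_eq_sum_smul (hT : T ∈ P.simplices) (hx : x ∈ hull T)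
    (A : Finset (EuclideanSpace ℝ (Fin d))) :
    P.faceProj A x = ∑ v ∈ A ∩ T, ((P.faceWeight A x)⁻¹ * P.bary T v x) • v := by
  rw [faceProj, sum_hat_smul hT hx A fun v => v, Finset.smul_sum]
  simp only [smul_smul]

end

lemma faceWeight_nonneg (hT : T ∈ P.simplices) (hx : x ∈ hull T)
    (A : Finset (EuclideanSpace ℝ (Fin d))) : 0 ≤ P.faceWeight A x := by
  classical
  rw [faceWeight_eq_sum_bary hT hx]
  exact Finset.sum_nonneg fun v _ => (mem_hull_iff hT).1 hx v

lemma faceProj_mem_hull (hT : T ∈ P.simplices) (hx : x ∈ hull T) (hA : P.faceWeight A x ≠ 0) :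
    P.faceProj A x ∈ hull T := by
  classical
  exact convexHull_mono (Finset.coe_subset.2 Finset.inter_subset_right)
    (Finset.mem_convexHull'.2 ⟨fun v => (P.faceWeight A x)⁻¹ * P.bary T v x,
      fun v _ => mul_nonneg (inv_nonneg.2 (faceWeight_nonneg hT hx A)) ((mem_hull_iff hT).1 hx v),
      sum_inv_faceWeight_mul_bary hT hx hA, (faceProj_eq_sum_smul hT hx A).symm⟩)

lemma bary_faceProj_eq_zero (hT : T ∈ P.simplices) (hx : x ∈ hull T) (hA : P.faceWeight A x ≠ 0)
    (hv : P.bary T v x = 0) : P.bary T v (P.faceProj A x) = 0 := by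
  classical
  rw [faceProj_eq_sum_smul hT hx, bary_apply_sum_smul hT Finset.inter_subset_right
    (sum_inv_faceWeight_mul_bary hT hx hA), hv, mul_zero, ite_self]

lemma sum_hat_smul_eq_zero (hT : T ∈ P.simplices) (hx : x ∈ hull T)
    (hA : P.faceWeight A x = 0) : ∑ v ∈ A, P.hat v x • v = 0 := by
  have hat_nonneg (v) (_ : v ∈ A) : 0 ≤ P.hat v x := by
    rw [hat_eq_bary hT hx]
    exact (mem_hull_iff hT).1 hx v
  exact Finset.sum_eq_zero fun v hv => by
    rw [(Finset.sum_eq_zero_iff_of_nonneg hat_nonneg).1 hA v hv, zero_smul]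

lemma exists_polyFun_eq_faceWeight (hT : T ∈ P.simplices)
    (A : Finset (EuclideanSpace ℝ (Fin d))) :
    ∃ s : MvPolynomial (Fin d) ℝ, s.totalDegree ≤ 1 ∧
      ∀ x ∈ hull T, polyFun s x = P.faceWeight A x := by
  classical
  choose b hb hb_eq using fun v => exists_polyFun_eq_affineMap (P.bary T v)
  refine ⟨∑ v ∈ A ∩ T, b v, MvPolynomial.totalDegree_finsetSum_le fun v _ => hb v, fun x hx => ?_⟩
  rw [map_sum, Finset.sum_apply, faceWeight_eq_sum_bary hT hx]
  simp only [hb_eq]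

lemma exists_polyFun_eq_sum_hat_smul (hT : T ∈ P.simplices)
    (A : Finset (EuclideanSpace ℝ (Fin d))) (i : Fin d) :
    ∃ m : MvPolynomial (Fin d) ℝ, m.totalDegree ≤ 1 ∧
      ∀ x ∈ hull T, polyFun m x = (∑ v ∈ A, P.hat v x • v) i := by
  classical
  choose b hb hb_eq using fun v => exists_polyFun_eq_affineMap (P.bary T v)
  refine ⟨∑ v ∈ A ∩ T, v i • b v, MvPolynomial.totalDegree_finsetSum_le fun v _ =>
    (MvPolynomial.totalDegree_smul_le _ _).trans (hb v), fun x hx => ?_⟩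
  rw [sum_hat_smul hT hx A fun v => v]
  simp only [map_sum, map_smul, hb_eq, Finset.sum_apply, Pi.smul_apply, WithLp.ofLp_sum,
    PiLp.smul_apply, smul_eq_mul, mul_comm]

lemma isSpline_faceRestrict (hn : n ≠ 0) (A : Finset (EuclideanSpace ℝ (Fin d)))
    (hu : P.IsSpline 0 n u) : P.IsSpline 0 n (P.faceRestrict n A u) := by
  refine isSpline_zero_of_forall_exists_polyFun fun T hT => ?_
  obtain ⟨p, hp, hup⟩ := hu.exists_polyFun hT
  obtain ⟨s, hs, hs_eq⟩ := exists_polyFun_eq_faceWeight hT A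
  choose m hm hm_eq using exists_polyFun_eq_sum_hat_smul hT A
  obtain ⟨q, hq, hq_eq⟩ := exists_eval_eq_pow_mul_eval hn hp hs hm
  refine ⟨q, hq, fun x hx => ?_⟩
  have s_eq_zero_imp (hsx : MvPolynomial.eval (fun j => x j) s = 0) (i : Fin d) :
      MvPolynomial.eval (fun j => x j) (m i) = 0 := by
    rw [← polyFun_apply] at hsx ⊢
    rw [hm_eq i x hx, sum_hat_smul_eq_zero hT hx ((hs_eq x hx).symm.trans hsx), PiLp.zero_apply]
  have q_apply : polyFun q x = P.faceWeight A x ^ n * polyFun p (P.faceProj A x) := by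
    rw [polyFun_apply, hq_eq _ s_eq_zero_imp]
    simp only [← polyFun_apply, hs_eq x hx, hm_eq _ x hx]
    rfl
  rw [q_apply, faceRestrict]
  by_cases hA : P.faceWeight A x = 0
  · rw [hA, zero_pow hn, zero_mul, zero_mul]
  · rw [hup (faceProj_mem_hull hT hx hA)]

lemma IsSplineZero.faceRestrict (hn : n ≠ 0) (A : Finset (EuclideanSpace ℝ (Fin d)))
    (hu : P.IsSplineZero 0 n u) : P.IsSplineZero 0 n (P.faceRestrict n A u) := by
  refine ⟨isSpline_faceRestrict hn A hu.1, fun x hx => ?_⟩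
  obtain ⟨T, hT, hxT⟩ := mem_domain_iff.1 (isCompact_domain.isClosed.frontier_subset hx)
  rw [SimplicialPartition.faceRestrict]
  by_cases hA : P.faceWeight A x = 0
  · rw [hA, zero_pow hn, zero_mul]
  · have faceProj_mem_frontier : P.faceProj A x ∈ frontier P.domain :=
      mem_frontier_domain_of_bary_eq_zero_imp hT hxT (faceProj_mem_hull hT hxT hA)
        (fun _ => bary_faceProj_eq_zero hT hxT hA) hx
    rw [hu.2 _ faceProj_mem_frontier, mul_zero]

lemma faceRestrict_of_faceWeight_eq_zero (hn : n ≠ 0) (hA : P.faceWeight A x = 0) :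
    P.faceRestrict n A u x = 0 := by
  rw [faceRestrict, hA, zero_pow hn, zero_mul]

lemma faceRestrict_of_notMem_domain (hn : n ≠ 0) (hx : x ∉ P.domain) :
    P.faceRestrict n A u x = 0 :=
  faceRestrict_of_faceWeight_eq_zero hn
    (Finset.sum_eq_zero fun _ _ => dif_neg fun h => hx (mem_domain_iff.2 h))

lemma faceRestrict_insert [DecidableEq (EuclideanSpace ℝ (Fin d))] (hvA : v ∉ A)
    (hx : P.hat v x = 0) : P.faceRestrict n (insert v A) u x = P.faceRestrict n A u x := by
  simp only [faceRestrict, faceProj, faceWeight, Finset.sum_insert hvA, hx, zero_add, zero_smul]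

lemma faceRestrict_eq_self (hT : T ∈ P.simplices) (hTA : T ⊆ A) (hx : x ∈ hull T) :
    P.faceRestrict n A u x = u x := by
  classical
  have faceWeight_eq_one : P.faceWeight A x = 1 := by
    rw [faceWeight_eq_sum_bary hT hx, Finset.inter_eq_right.2 hTA, sum_bary hT]
  rw [faceRestrict, faceProj_eq_sum_smul hT hx, Finset.inter_eq_right.2 hTA, faceWeight_eq_one]
  simp only [inv_one, one_mul, sum_bary_smul hT, one_pow]

end SimplicialPartition

/-! ### A local Riesz basis for continuous splines -/

lemma exists_isRieszFamily_of_linearIndependent {ι H : Type*} [Fintype ι] [NormedAddCommGroup H]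
    [InnerProductSpace ℝ H] {b : ι → H} (hb : LinearIndependent ℝ b) :
    ∃ C₁ C₂ : ℝ, 0 < C₁ ∧ IsRieszFamily b C₁ C₂ := by
  let combination : EuclideanSpace ℝ ι →ₗ[ℝ] H :=
    Fintype.linearCombination ℝ b ∘ₗ (WithLp.linearEquiv 2 ℝ (ι → ℝ)).toLinearMap
  have combination_apply (c : ι → ℝ) :
      combination (WithLp.toLp 2 c) = ∑ i, c i • b i := rfl
  have combination_injective : Function.Injective combination :=
    (hb.fintypeLinearCombination_injective).comp (WithLp.linearEquiv 2 ℝ (ι → ℝ)).injective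
  obtain ⟨C, hC⟩ := exists_norm_le_mul_norm_of_ker_le_ker combination
    (LinearMap.id : EuclideanSpace ℝ ι →ₗ[ℝ] EuclideanSpace ℝ ι)
    (by rw [LinearMap.ker_eq_bot.2 combination_injective]; exact bot_le)
  refine ⟨(max C 1 ^ 2)⁻¹, ‖combination.toContinuousLinearMap‖ ^ 2, by positivity, fun c => ?_⟩
  rw [← combination_apply, ← EuclideanSpace.real_norm_sq_eq (WithLp.toLp 2 c), ← mul_pow]
  constructor
  · rw [inv_mul_le_iff₀ (by positivity), ← mul_pow]
    gcongr
    exact (hC _).trans (by gcongr; exact le_max_left C 1)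
  · gcongr
    exact combination.toContinuousLinearMap.le_opNorm _

lemma exists_fin_basis_mem_of_span_eq_top {K V : Type*} [DivisionRing K] [AddCommGroup V]
    [Module K V] [FiniteDimensional K V] {s : Set V} (hs : Submodule.span K s = ⊤) :
    ∃ (m : ℕ) (b : Module.Basis (Fin m) K V), ∀ i, b i ∈ s := by
  have := Module.Finite.finite_basis (Module.Basis.ofSpan hs.ge)
  obtain ⟨m, ⟨e⟩⟩ := Finite.exists_equiv_fin
    ((linearIndepOn_empty K id).extend (empty_subset s))
  refine ⟨m, (Module.Basis.ofSpan hs.ge).reindex e, fun i => ?_⟩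
  rw [Module.Basis.reindex_apply]
  exact Module.Basis.ofSpan_subset hs.ge (mem_range_self _)

namespace SimplicialPartition

variable {d r n : ℕ} {P : SimplicialPartition d} {u : EuclideanSpace ℝ (Fin d) → ℝ}
  {v : EuclideanSpace ℝ (Fin d)} {A : Finset (EuclideanSpace ℝ (Fin d))}

variable (P r n) in
/-- The space of splines that vanish on the boundary, normalized to be zero off the domain. -/
def zeroSplineSpace : Submodule ℝ (EuclideanSpace ℝ (Fin d) → ℝ) where
  carrier := {u | P.IsSplineZero r n u ∧ ∀ x ∉ P.domain, u x = 0}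
  zero_mem' := ⟨⟨zero_mem (P.splineSpace r n), fun _ _ => rfl⟩, fun _ _ => rfl⟩
  add_mem' := fun {u v} hu hv =>
    ⟨⟨add_mem (S := Submodule ℝ _) (s := P.splineSpace r n) hu.1.1 hv.1.1,
      fun x hx => by rw [Pi.add_apply, hu.1.2 x hx, hv.1.2 x hx, add_zero]⟩,
      fun x hx => by rw [Pi.add_apply, hu.2 x hx, hv.2 x hx, add_zero]⟩
  smul_mem' := fun c u hu =>
    ⟨⟨(P.splineSpace r n).smul_mem c hu.1.1,
      fun x hx => by rw [Pi.smul_apply, hu.1.2 x hx, smul_zero]⟩,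
      fun x hx => by rw [Pi.smul_apply, hu.2 x hx, smul_zero]⟩

lemma zeroSplineSpace_le_splineSpace : P.zeroSplineSpace r n ≤ P.splineSpace r n :=
  fun _ hu => hu.1.1

open Classical in
instance finiteDimensional_zeroSplineSpace : FiniteDimensional ℝ (P.zeroSplineSpace r n) := by
  have := P.simplices_finite.to_subtype
  let glue : (P.simplices → MvPolynomial.restrictTotalDegree (Fin d) ℝ n) →ₗ[ℝ]
      (EuclideanSpace ℝ (Fin d) → ℝ) :=
    LinearMap.pi fun x => if h : ∃ T : P.simplices, x ∈ hull T.1 then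
      LinearMap.proj x ∘ₗ polyFun ∘ₗ Submodule.subtype _ ∘ₗ LinearMap.proj h.choose else 0
  have le_range : P.zeroSplineSpace r n ≤ glue.range := by
    rintro u ⟨⟨hu, -⟩, hu_off⟩
    choose p hp hup using fun T : P.simplices => hu.exists_polyFun T.2
    refine ⟨fun T => ⟨p T, (MvPolynomial.mem_restrictTotalDegree _ _ _).2 (hp T)⟩, ?_⟩
    ext x
    by_cases h : ∃ T : P.simplices, x ∈ hull T.1
    · simp only [glue, LinearMap.pi_apply, dif_pos h]
      exact (hup _ h.choose_spec).symm
    · simp only [glue, LinearMap.pi_apply, dif_neg h]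
      refine (hu_off x fun hx => h ?_).symm
      obtain ⟨T, hT, hxT⟩ := mem_domain_iff.1 hx
      exact ⟨⟨T, hT⟩, hxT⟩
  exact Submodule.finiteDimensional_of_le le_range

lemma indicator_mem_zeroSplineSpace (hu : P.IsSplineZero 0 n u) :
    P.domain.indicator u ∈ P.zeroSplineSpace 0 n := by
  refine ⟨⟨isSpline_zero_of_forall_exists_polyFun fun T hT => ?_, fun x hx => ?_⟩,
    fun x hx => indicator_of_notMem hx u⟩
  · obtain ⟨p, hp, hup⟩ := hu.1.exists_polyFun hT
    exact ⟨p, hp, fun x hx => by rw [indicator_of_mem (hull_subset_domain hT hx), hup hx]⟩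
  · rw [indicator_of_mem (isCompact_domain.isClosed.frontier_subset hx), hu.2 x hx]

variable (P r n) in
/-- The restriction of `SimplicialPartition.splineGradient` to the splines that vanish on the
boundary. -/
def zeroSplineGradient : P.zeroSplineSpace r n →ₗ[ℝ] Lp (EuclideanSpace ℝ (Fin d)) 2
    (volume.restrict P.domain) :=
  P.splineGradient r n ∘ₗ Submodule.inclusion zeroSplineSpace_le_splineSpace

lemma ker_zeroSplineGradient (hd : 1 ≤ d) : (P.zeroSplineGradient r n).ker = ⊥ := by
  refine LinearMap.ker_eq_bot'.2 fun u hu => Subtype.ext (funext fun x => ?_)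
  by_cases hx : x ∈ P.domain
  · refine u.2.1.eq_zero_of_energy_eq_zero hd ?_ hx
    have energy_eq := norm_splineGradient_sq (Submodule.inclusion zeroSplineSpace_le_splineSpace u)
    rw [show P.splineGradient r n _ = 0 from hu, norm_zero, zero_pow two_ne_zero] at energy_eq
    exact energy_eq.symm
  · exact u.2.2 x hx

variable (P r n) in
/-- The splines that vanish on the boundary and are supported in `star^l` of some simplex. -/
def localSplines (l : ℕ) : Set (P.zeroSplineSpace r n) :=
  {u | ∃ T ∈ P.simplices, ∀ x ∈ P.domain, x ∉ P.starSet T l → u.1 x = 0}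

lemma faceRestrict_mem_zeroSplineSpace (hn : n ≠ 0) (A : Finset (EuclideanSpace ℝ (Fin d)))
    (hu : P.IsSplineZero 0 n u) : P.faceRestrict n A u ∈ P.zeroSplineSpace 0 n :=
  ⟨hu.faceRestrict hn A, fun _ hx => faceRestrict_of_notMem_domain hn hx⟩

lemma faceRestrict_insert_of_notMem_starSet [DecidableEq (EuclideanSpace ℝ (Fin d))]
    {T : Finset (EuclideanSpace ℝ (Fin d))} (hvA : v ∉ A) (hv : v ∈ T)
    {x : EuclideanSpace ℝ (Fin d)} (hx : x ∈ P.domain) (hxT : x ∉ P.starSet T 1) :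
    P.faceRestrict n (insert v A) u x = P.faceRestrict n A u x := by
  refine faceRestrict_insert hvA (hat_eq_zero hx fun hxv => hxT ?_)
  obtain ⟨T', ⟨hT', q, hq, hqv⟩, hxT'⟩ := mem_iUnion₂.1 hxv
  exact mem_biUnion ⟨hT', q, hq, Finset.mem_singleton.1 hqv ▸ hv⟩ hxT'

theorem span_localSplines (hn : n ≠ 0) : Submodule.span ℝ (P.localSplines 0 n 1) = ⊤ := by
  classical
  rw [eq_top_iff]
  rintro ⟨u, hu⟩ -
  let restrict (A : Finset (EuclideanSpace ℝ (Fin d))) : P.zeroSplineSpace 0 n :=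
    ⟨P.faceRestrict n A u, faceRestrict_mem_zeroSplineSpace hn A hu.1⟩
  set vertices : Finset (EuclideanSpace ℝ (Fin d)) := P.simplices_finite.toFinset.biUnion id
    with vertices_def
  have mem_vertices {v} : v ∈ vertices ↔ ∃ T ∈ P.simplices, v ∈ T := by
    simp [vertices_def]
  have restrict_vertices : restrict vertices = ⟨u, hu⟩ := by
    refine Subtype.ext (funext fun x => ?_)
    by_cases hx : x ∈ P.domain
    · obtain ⟨T, hT, hxT⟩ := mem_domain_iff.1 hx
      exact faceRestrict_eq_self hT (fun v hv => mem_vertices.2 ⟨T, hT, hv⟩) hxT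
    · exact (faceRestrict_of_notMem_domain hn hx).trans (hu.2 x hx).symm
  rw [← restrict_vertices]
  suffices ∀ A ⊆ vertices, restrict A ∈ Submodule.span ℝ (P.localSplines 0 n 1) from
    this _ subset_rfl
  intro A
  induction A using Finset.induction_on with
  | empty =>
    intro _
    have restrict_empty : restrict ∅ = 0 :=
      Subtype.ext (funext fun x => faceRestrict_of_faceWeight_eq_zero hn Finset.sum_empty)
    exact restrict_empty ▸ Submodule.zero_mem _
  | insert v A hvA ih =>
    intro hA
    obtain ⟨T, hT, hvT⟩ := mem_vertices.1 (hA (Finset.mem_insert_self v A))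
    have increment_mem : restrict (insert v A) - restrict A ∈ P.localSplines 0 n 1 :=
      ⟨T, hT, fun x hx hxT =>
        sub_eq_zero.2 (faceRestrict_insert_of_notMem_starSet hvA hvT hx hxT)⟩
    rw [← sub_add_cancel (restrict (insert v A)) (restrict A)]
    exact Submodule.add_mem _ (Submodule.subset_span increment_mem)
      (ih ((Finset.subset_insert v A).trans hA))

theorem exists_hasLocalRieszBasis_zero (hd : 1 ≤ d) (hn : n ≠ 0) (P : SimplicialPartition d) :
    ∃ κ : ℝ, P.HasLocalRieszBasis 0 n 1 κ := by
  obtain ⟨m, b, hb_local⟩ := exists_fin_basis_mem_of_span_eq_top (span_localSplines (P := P) hn)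
  obtain ⟨C₁, C₂, hC₁, hriesz⟩ := exists_isRieszFamily_of_linearIndependent
    (b.linearIndependent.map' _ (ker_zeroSplineGradient hd))
  choose τ hτ using hb_local
  have coe_sum (c : Fin m → ℝ) : ((∑ ξ, c ξ • b ξ : P.zeroSplineSpace 0 n) :
      EuclideanSpace ℝ (Fin d) → ℝ) = fun x => ∑ ξ, c ξ * (b ξ).1 x := by
    ext x
    simp [Finset.sum_apply]
  refine ⟨C₂ / C₁, m, fun ξ => (b ξ).1, τ, C₁, C₂, hC₁, (div_mul_cancel₀ _ hC₁.ne').ge,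
    fun ξ => (b ξ).2.1, hτ, fun u hu => ?_, fun c => ?_⟩
  · let w : P.zeroSplineSpace 0 n := ⟨P.domain.indicator u, indicator_mem_zeroSplineSpace hu⟩
    refine ⟨b.repr w, fun x hx => ?_⟩
    rw [← congrFun (coe_sum _) x, b.sum_repr]
    exact (indicator_of_mem hx u).symm
  · have energy_eq : ‖∑ ξ, c ξ • P.zeroSplineGradient 0 n (b ξ)‖ ^ 2 =
        P.energy fun x => ∑ ξ, c ξ * (b ξ).1 x := by
      rw [← coe_sum]
      simp only [← map_smul, ← map_sum]
      exact norm_splineGradient_sq _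
    exact energy_eq ▸ hriesz c

end SimplicialPartition

end GBC

end

theorem mainTheorem2_general :
    (∀ (κ : ℝ) (l : ℕ), 1 ≤ l → ∃ σ : ℝ, 0 < σ ∧ σ < 1 ∧
      ∀ (d n : ℕ) (β A : ℝ), 2 ≤ d → 1 ≤ n → ∃ K : ℝ, 0 < K ∧
        ∀ (r : ℕ) (P : GBC.SimplicialPartition d), P.QuasiUniform β →
          P.HasLocalRieszBasis r n l κ →
          ∀ p ∈ P.complex.vertices, p ∈ frontier P.domain →
            (r = 0 ∨ P.HasLocalLift r n l A p) →
            ∀ S : EuclideanSpace ℝ (Fin d) → ℝ, P.IsBoundaryGBCSpline r n p S →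
              ∀ T ∈ P.simplices, ∀ v ∈ convexHull ℝ (T : Set (EuclideanSpace ℝ (Fin d))),
              ∀ k : ℕ, 1 ≤ k → Disjoint (P.starSet T k) (P.starSet {p} 1) →
                |S v| ≤ K * σ ^ k) ∧
    (∀ (d n : ℕ), 1 ≤ d → 1 ≤ n → ∀ P : GBC.SimplicialPartition d,
      ∃ κ : ℝ, P.HasLocalRieszBasis 0 n 1 κ) := by
  refine ⟨fun κ l hl => ?_, fun d n hd hn P =>
    GBC.SimplicialPartition.exists_hasLocalRieszBasis_zero hd (Nat.one_le_iff_ne_zero.1 hn) P⟩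
  obtain ⟨σ, hσ, hσ_lt, hdecay⟩ :=
    GBC.SimplicialPartition.exists_abs_le_mul_pow_of_hasLocalLift κ l
  refine ⟨σ, hσ, hσ_lt, fun d n β A hd hn => ?_⟩
  set hatBound := (2 * β) ^ 2 * volume.real (Metric.ball (0 : EuclideanSpace ℝ (Fin d)) 1)
  obtain ⟨K, hK, hbound⟩ := hdecay d n β (max A hatBound) hd
  refine ⟨K, hK, fun r P hP hbasis p hp hpf hlift => ?_⟩
  have hasLocalLift : P.HasLocalLift r n l (max A hatBound) p := by
    rcases hlift with rfl | hlift
    · exact (hP.hasLocalLift_zero hd hn hl p).mono (le_max_right _ _)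
    · exact hlift.mono (le_max_left _ _)
  exact hbound r P hP hbasis p hp hpf hasLocalLift

theorem mainTheorem2 :
    (∀ (κ : ℝ) (l : ℕ), 1 ≤ l → ∃ σ : ℝ, 0 < σ ∧ σ < 1 ∧
      ∀ (d n : ℕ) (β A : ℝ), 2 ≤ d → 1 ≤ n → ∃ K : ℝ, 0 < K ∧
        ∀ (r : ℕ) (P : GBC.SimplicialPartition d), P.QuasiUniform β →
          P.HasLocalRieszBasis r n l κ →
          ∀ p ∈ P.complex.vertices, p ∈ frontier P.domain →
            (r = 0 ∨ P.HasLocalLift r n l A p) →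
            ∀ S : EuclideanSpace ℝ (Fin d) → ℝ, P.IsBoundaryGBCSpline r n p S →
              ∀ v ∈ P.domain, v ∉ P.starSet {p} 1 →
              ∀ T ∈ P.simplices, v ∈ convexHull ℝ (T : Set (EuclideanSpace ℝ (Fin d))) →
              ∀ k : ℕ, 1 ≤ k → Disjoint (P.starSet T k) (P.starSet {p} 1) →
              ∀ L : ℕ, 1 ≤ L → P.IsSimplicesAwayOpposite p k T L →
                |S v| ≤ K * (L + 1) * σ ^ k) ∧
    (∀ (d n : ℕ), 2 ≤ d → 1 ≤ n → ∀ P : GBC.SimplicialPartition d,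
      ∃ κ : ℝ, P.HasLocalRieszBasis 0 n 1 κ) := by
  refine mainTheorem2_general.imp (fun hdecay κ l hl => ?_) fun hbasis d n hd => hbasis d n (by lia)
  obtain ⟨σ, hσ, hσ_lt, hdecay⟩ := hdecay κ l hl
  refine ⟨σ, hσ, hσ_lt, fun d n β A hd hn => ?_⟩
  obtain ⟨K, hK, hbound⟩ := hdecay d n β A hd hn
  refine ⟨K, hK, fun r P hP hbasis p hp hpf hlift S hS v _ _ T hT hvT k hk hdisj L _ _ => ?_⟩
  calc |S v| ≤ K * σ ^ k := hbound r P hP hbasis p hp hpf hlift S hS T hT v hvT k hk hdisj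
    _ ≤ K * (L + 1) * σ ^ k := by
      gcongr
      exact le_mul_of_one_le_right hK.le (by simp)
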